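/- Let $N\ge 3$ be an integer and $1<p<N$. Let $A:(0,\infty)\to(0,\infty)$ be continuous, and suppose that there are $a_0,a_\infty\in(p-N,p]$ such that $$0<\liminf_{r\to0^+}\frac{A(r)}{r^{a_0}}\le\limsup_{r\to0^+}\frac{A(r)}{r^{a_0}}<+\infty,\qquad 0<\liminf_{r\to+\infty}\frac{A(r)}{r^{a_\infty}}\le\limsup_{r\to+\infty}\frac{A(r)}{r^{a_\infty}}<+\infty .$$ Let $V:(0,\infty)\to[0,\infty)$ be measurable with $V\in L^1_{\mathrm{loc}}((0,\infty))$, and let $K:(0,\infty)\to(0,\infty)$ be measurable with $K\in L^s_{\mathrm{loc}}((0,\infty))$ for some $s>1$. Let $S_A$ be the set of radial $u\in C_c^\infty(\mathbb R^N)$ with $\|u\|_A:=\left(\int_{\mathbb R^N}A(|x|)|\nabla u|^p\,dx\right)^{1/p}<\infty$, and let $D_A$ be the completion of $S_A$ with respect to $\|\cdot\|_A$, realized as a space of functions (classes modulo equality almost everywhere): a Cauchy sequence in $S_A$ is identified with its almost everywhere limit, whose norm $\|\cdot\|_A$ is the limit of the norms. Set $$X:=D_A\cap L^p(\mathbb R^N,V(|x|)\,dx),\qquad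 \|u\|:=\Big(\|u\|_A^p+\int_{\mathbb R^N}V(|x|)|u|^p\,dx\Big)^{1/p},$$ and, for $q>1$ and $R>0$, with $B_R=\{x\in\mathbb R^N:|x|<R\}$, $$\mathcal S_0(q,R):=\sup_{u\in X,\ \|u\|=1}\int_{B_R}K(|x|)|u|^q\,dx\in[0,+\infty].$$ For $a>p-N$ and $\alpha,\beta,\gamma\in\mathbb R$ put $$q_*(\alpha,\beta,\gamma):=p\,\frac{\alpha-\gamma\beta+N}{N-\gamma},\qquad q_{**}(a,\alpha,\beta,\gamma):=p\,\frac{p\alpha+(1-p\beta)\gamma+p(N-1)+a}{p(N-1)-\gamma(p-1)+a}$$ whenever the denominators do not vanish. For $a>p-N$, $\beta\in[0,1]$, $\gamma\ge p-a$, let $\gamma^*:=\frac{p(N-1)+a}{p-1}$ (so that $\gamma^*>N$), and let $\mathcal A_{a,\beta,\gamma}$ be the set of all $(\alpha,q)\in\mathbb R^2$ such that, with $q_*=q_*(\alpha,\beta,\gamma)$ and $q_{**}=q_{**}(a,\alpha,\beta,\gamma)$, - $\max\{1,p\beta\}<q<\min\{q_*,q_{**}\}$, if $p-a\le\gamma<N$;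 - $\max\{1,p\beta\}<q<q_{**}$ and $\alpha>-(1-\beta)N$, if $\gamma=N$; - $\max\{1,p\beta,q_*\}<q<q_{**}$, if $N<\gamma<\gamma^*$; - $\max\{1,p\beta,q_*\}<q$ and $\alpha>-(1-\beta)\gamma$, if $\gamma=\gamma^*$; - $\max\{1,p\beta,q_*,q_{**}\}<q$, if $\gamma>\gamma^*$. **Theorem.** Assume that there exist $R_1>0$, $\beta_0\in[0,1]$, $\alpha_0\in\mathbb R$ and $\gamma_0\ge p-a_0$ such that $$\operatorname*{ess\,sup}_{r\in(0,R_1)}\frac{K(r)}{r^{\alpha_0}V(r)^{\beta_0}}<+\infty\qquad\text{and}\qquad \operatorname*{ess\,inf}_{r\in(0,R_1)}r^{\gamma_0}V(r)>0$$ (where $V(r)^0:=1$). Then $\displaystyle\lim_{R\to0^+}\mathcal S_0(q_1,R)=0$ for every $q_1\in\mathbb R$ such that $(\alpha_0,q_1)\in\mathcal A_{a_0,\beta_0,\gamma_0}$. -/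

import Mathlib

open Filter Topology MeasureTheory Set
open scoped ENNReal ContDiff Gradient

noncomputable section

namespace RadialQuasilinear

/-- Hypothesis on `A : (0, ∞) → (0, ∞)`: it is continuous, and `A(r) / r ^ a₀` as `r → 0⁺`,
`A(r) / r ^ aInf` as `r → +∞` have positive lower limit and finite upper limit, with
`a₀, aInf ∈ (p - N, p]`. A function on `(0, ∞)` is represented by a function on `ℝ`
whose values outside `(0, ∞)` play no role. The limits are taken in the extended reals. -/
structure HypA (N : ℕ) (p a₀ aInf : ℝ) (A : ℝ → ℝ) : Prop where
  continuousOn : ContinuousOn A (Ioi 0)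
  pos : ∀ r, 0 < r → 0 < A r
  mem_zero : a₀ ∈ Ioc (p - N) p
  mem_infty : aInf ∈ Ioc (p - N) p
  liminf_zero : ∃ c₀ : ℝ, 0 < c₀ ∧
    (c₀ : EReal) ≤ liminf (fun r : ℝ => ((A r / r ^ a₀ : ℝ) : EReal)) (𝓝[>] 0)
  limsup_zero : limsup (fun r : ℝ => ((A r / r ^ a₀ : ℝ) : EReal)) (𝓝[>] 0) < ⊤
  liminf_infty : ∃ cInf : ℝ, 0 < cInf ∧
    (cInf : EReal) ≤ liminf (fun r : ℝ => ((A r / r ^ aInf : ℝ) : EReal)) atTop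
  limsup_infty : limsup (fun r : ℝ => ((A r / r ^ aInf : ℝ) : EReal)) atTop < ⊤

/-- Hypothesis on `V`: (Lebesgue) measurable, nonnegative and in `L¹_loc` on `(0, ∞)`. -/
structure HypV (V : ℝ → ℝ) : Prop where
  measurable : AEMeasurable V (volume.restrict (Ioi 0))
  nonneg : ∀ r, 0 < r → 0 ≤ V r
  locallyIntegrable : LocallyIntegrableOn V (Ioi 0)

/-- Hypothesis on `K`: (Lebesgue) measurable, positive and in `L^s_loc` on `(0, ∞)` for some
`s > 1`. -/
structure HypK (K : ℝ → ℝ) : Prop where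
  measurable : AEMeasurable K (volume.restrict (Ioi 0))
  pos : ∀ r, 0 < r → 0 < K r
  locallyIntegrable : ∃ s : ℝ, 1 < s ∧ LocallyIntegrableOn (fun r => K r ^ s) (Ioi 0)

variable {N : ℕ}

/-- `‖φ‖_A = (∫ A(|x|) |∇φ|^p dx)^(1/p)` for a smooth `φ`, as an extended nonnegative number. -/
def normA (A : ℝ → ℝ) (p : ℝ) (φ : EuclideanSpace ℝ (Fin N) → ℝ) : ℝ≥0∞ :=
  (∫⁻ x, ENNReal.ofReal (A ‖x‖ * ‖∇ φ x‖ ^ p)) ^ (1 / p)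

/-- `S_A`: the radial functions in `C_c^∞(ℝ^N)` with `‖φ‖_A < ∞`. -/
structure MemSA (A : ℝ → ℝ) (p : ℝ) (φ : EuclideanSpace ℝ (Fin N) → ℝ) : Prop where
  contDiff : ContDiff ℝ ∞ φ
  hasCompactSupport : HasCompactSupport φ
  radial : ∀ x y, ‖x‖ = ‖y‖ → φ x = φ y
  norm_lt_top : normA A p φ < ⊤

/-- `HasNormD A p u a`: the function `u` belongs to `D_A`, the completion of `S_A`, and
`‖u‖_A = a`. As usual an element of the completion is the class of an `‖·‖_A`-Cauchy sequence in
`S_A`, its norm is the limit of the norms, and the class is identified with the function that is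
the almost everywhere limit of the sequence. -/
def HasNormD (A : ℝ → ℝ) (p : ℝ) (u : EuclideanSpace ℝ (Fin N) → ℝ) (a : ℝ≥0∞) : Prop :=
  ∃ φ : ℕ → EuclideanSpace ℝ (Fin N) → ℝ,
    (∀ n, MemSA A p (φ n)) ∧
    Tendsto (fun k : ℕ × ℕ => normA A p (φ k.1 - φ k.2)) atTop (𝓝 0) ∧
    (∀ᵐ x, Tendsto (fun n => φ n x) atTop (𝓝 (u x))) ∧
    Tendsto (fun n => normA A p (φ n)) atTop (𝓝 a)

/-- `HasNormX A V p u t`: the function `u` belongs to `X = D_A ∩ L^p(ℝ^N, V(|x|) dx)` and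
`‖u‖ = (‖u‖_A^p + ∫ V(|x|) |u|^p dx)^(1/p) = t`, a finite number. -/
def HasNormX (A V : ℝ → ℝ) (p : ℝ) (u : EuclideanSpace ℝ (Fin N) → ℝ) (t : ℝ≥0∞) : Prop :=
  t < ⊤ ∧ ∃ a, HasNormD A p u a ∧
    t = (a ^ p + ∫⁻ x, ENNReal.ofReal (V ‖x‖ * |u x| ^ p)) ^ (1 / p)

/-- `𝓢₀(q, R) = sup {∫_{B_R} K(|x|) |u|^q dx : u ∈ X, ‖u‖ = 1}`, possibly infinite. -/
def S₀ (N : ℕ) (A V K : ℝ → ℝ) (p q R : ℝ) : ℝ≥0∞ :=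
  ⨆ (u : EuclideanSpace ℝ (Fin N) → ℝ) (_ : HasNormX A V p u 1),
    ∫⁻ x in Metric.ball 0 R, ENNReal.ofReal (K ‖x‖ * |u x| ^ q)

/-- `q_*(α, β, γ)`, meaningful for `γ ≠ N`. -/
def qStar (N : ℕ) (p α β γ : ℝ) : ℝ := p * ((α - γ * β + N) / (N - γ))

/-- `q_**(a, α, β, γ)`, meaningful for `γ ≠ (p (N - 1) + a) / (p - 1)`. -/
def qStarStar (N : ℕ) (p a α β γ : ℝ) : ℝ :=
  p * ((p * α + (1 - p * β) * γ + p * (N - 1) + a) / (p * (N - 1) - γ * (p - 1) + a))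

/-- The region `𝓐_{a, β, γ}` of the `(α, q)` plane, for `γ ≥ p - a`. -/
def region (N : ℕ) (p a β γ : ℝ) : Set (ℝ × ℝ) :=
  {z | (p - a ≤ γ ∧ γ < N ∧
          max 1 (p * β) < z.2 ∧
          z.2 < min (qStar N p z.1 β γ) (qStarStar N p a z.1 β γ)) ∨
       (γ = N ∧
          max 1 (p * β) < z.2 ∧ z.2 < qStarStar N p a z.1 β γ ∧ -(1 - β) * N < z.1) ∨
       (N < γ ∧ γ < (p * (N - 1) + a) / (p - 1) ∧
          max (max 1 (p * β)) (qStar N p z.1 β γ) < z.2 ∧ z.2 < qStarStar N p a z.1 β γ) ∨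
       (γ = (p * (N - 1) + a) / (p - 1) ∧
          max (max 1 (p * β)) (qStar N p z.1 β γ) < z.2 ∧ -(1 - β) * γ < z.1) ∨
       ((p * (N - 1) + a) / (p - 1) < γ ∧
          max (max 1 (p * β)) (max (qStar N p z.1 β γ) (qStarStar N p a z.1 β γ)) < z.2)}

end RadialQuasilinear

end

/-! Both arguments play the lower bound `V ≥ c r^(-γ)` near the origin against `∫ V|u|^p ≤ 1` on the
unit sphere of `X`; they differ according to the side of `p` on which `q` lies.

If `q < p`, Hölder's inequality with exponents `p/q` and `p/(p-q)` bounds `∫_{B_R} K|u|^q` by a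
power of `∫_{B_R} |x|^η`. This is finite and vanishes with `R` when `η + N > 0`, which is the `q_*`
inequality (`tendsto_S₀_of_lt`).

If `q ≥ p`, the surplus `|u|^(q-p)` is absorbed by a pointwise bound `|u(x)|^p ≤ C|x|^(-m)`, valid
near the origin with `pm = p(N-1) + a₀ - γ(p-1)`. Then `K|u|^q ≤ L|x|^ε V|u|^p`, and `ε > 0` is the
`q_**` inequality (`tendsto_S₀_of_le`).

The pointwise bound (`exists_ae_rpow_le`) comes from integrating the derivative of `|f|^p`, with `f`
the radial profile of `u`, and applying Hölder's inequality: one factor is the `A`-energy, the other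
is controlled by `∫ V|u|^p`. For `m ≥ 0` one integrates outwards to a fixed radius. For `m < 0` one
integrates inwards; then `γ > N`, and the finiteness of `∫ V|u|^p` prevents `|f|^p` from staying
away from zero at the origin (`IsRadialLimit.ofReal_rpow_le`). The estimates are proved for test
functions and passed to the limits that form `D_A`. -/

namespace RadialQuasilinear

/-! ### Polar coordinates and null sets. -/

section Polar

variable {E : Type*} [NormedAddCommGroup E] [NormedSpace ℝ E] [FiniteDimensional ℝ E]
  [MeasurableSpace E] [BorelSpace E] [Nontrivial E] (μ : Measure E) [μ.IsAddHaarMeasure]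

/-- Polar coordinates for the integral of a measurable radial function. -/
theorem lintegral_comp_norm_of_measurable {f : ℝ → ℝ≥0∞} (hf : Measurable f) :
    ∫⁻ x, f ‖x‖ ∂μ = μ.toSphere univ *
      ∫⁻ t in Ioi (0 : ℝ), ENNReal.ofReal (t ^ (Module.finrank ℝ E - 1)) * f t := by
  have hm : Measurable fun t : Ioi (0 : ℝ) => f t := hf.comp measurable_subtype_coe
  calc
    ∫⁻ x, f ‖x‖ ∂μ = ∫⁻ x : ({(0)}ᶜ : Set E), f (‖x.1‖) ∂(μ.comap (↑)) := by
      rw [lintegral_subtype_comap (measurableSet_singleton _).compl fun x ↦ f (‖x‖),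
        restrict_compl_singleton]
    _ = ∫⁻ x, f x.2 ∂μ.toSphere.prod (.volumeIoiPow (Module.finrank ℝ E - 1)) := by
      simpa using μ.measurePreserving_homeomorphUnitSphereProd.lintegral_comp_emb
        (Homeomorph.measurableEmbedding _) (f ∘ Subtype.val ∘ Prod.snd)
    _ = μ.toSphere univ *
        ∫⁻ x : Ioi (0 : ℝ), f x ∂.volumeIoiPow (Module.finrank ℝ E - 1) := by
      refine (lintegral_prod _ (hm.comp measurable_snd).aemeasurable).trans ?_
      simp [mul_comm]
    _ = _ := by
      rw [Measure.volumeIoiPow, lintegral_withDensity_eq_lintegral_mul _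
        ((measurable_subtype_coe.pow_const _).ennreal_ofReal) hm]
      congr 1
      exact lintegral_subtype_comap measurableSet_Ioi
        fun t : ℝ => ENNReal.ofReal (t ^ (Module.finrank ℝ E - 1)) * f t

/-- Transfers almost everywhere statements about `V` and `K` from the half line to space: by polar
coordinates, the shells over a null set of radii have measure zero. -/
theorem quasiMeasurePreserving_norm :
    Measure.QuasiMeasurePreserving (fun x : E => ‖x‖) μ (volume.restrict (Ioi 0)) := by
  refine ⟨measurable_norm, Measure.AbsolutelyContinuous.mk fun s hs h0 => ?_⟩
  rw [Measure.map_apply measurable_norm hs, ← lintegral_indicator_one (measurable_norm hs)]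
  have h := lintegral_comp_norm_of_measurable μ (f := s.indicator 1) (measurable_one.indicator hs)
  have h1 : ∫⁻ t in Ioi (0 : ℝ),
      ENNReal.ofReal (t ^ (Module.finrank ℝ E - 1)) * s.indicator 1 t = 0 := by
    rw [lintegral_congr_ae (g := fun _ => 0)]
    · simp
    · filter_upwards [measure_eq_zero_iff_ae_notMem.1 h0] with t ht
      simp [ht]
  rw [h1, mul_zero] at h
  exact h

/-- Polar coordinates for the integral of an almost everywhere measurable radial function. -/
theorem lintegral_comp_norm {f : ℝ → ℝ≥0∞} (hf : AEMeasurable f (volume.restrict (Ioi 0))) :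
    ∫⁻ x, f ‖x‖ ∂μ = μ.toSphere univ *
      ∫⁻ t in Ioi (0 : ℝ), ENNReal.ofReal (t ^ (Module.finrank ℝ E - 1)) * f t := by
  have h := (quasiMeasurePreserving_norm μ).ae_eq hf.ae_eq_mk
  refine (lintegral_congr_ae h).trans ?_
  refine (lintegral_comp_norm_of_measurable μ hf.measurable_mk).trans ?_
  congr 1
  refine lintegral_congr_ae ?_
  filter_upwards [hf.ae_eq_mk] with t ht
  rw [ht]

/-- A property that holds for almost all `r` in `(0, R)` holds for `r = ‖x‖`, for almost all `x`
in the ball of radius `R`. -/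
theorem ae_ball_of_ae_Ioo {R : ℝ} {P : ℝ → Prop}
    (h : ∀ᵐ r ∂(volume.restrict (Ioo 0 R)), P r) : ∀ᵐ x ∂μ, ‖x‖ < R → P ‖x‖ := by
  have h1 : ∀ᵐ r ∂(volume.restrict (Ioi (0 : ℝ))), r < R → P r := by
    rw [ae_restrict_iff' measurableSet_Ioo] at h
    rw [ae_restrict_iff' measurableSet_Ioi]
    filter_upwards [h] with r hr h0 hR using hr ⟨h0, hR⟩
  exact (quasiMeasurePreserving_norm μ).ae h1

end Polar

/-! ### Radial functions and their one-dimensional profiles. -/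

section Profile

variable {N : ℕ}

/-- The profile of a function along the ray spanned by `e`. -/
def profile (e : EuclideanSpace ℝ (Fin N)) (φ : EuclideanSpace ℝ (Fin N) → ℝ) (r : ℝ) : ℝ :=
  φ (r • e)

theorem profile_sub (e : EuclideanSpace ℝ (Fin N)) (φ ψ : EuclideanSpace ℝ (Fin N) → ℝ) :
    profile e (φ - ψ) = profile e φ - profile e ψ := rfl

theorem contDiff_profile (e : EuclideanSpace ℝ (Fin N)) {φ : EuclideanSpace ℝ (Fin N) → ℝ}
    (hφ : ContDiff ℝ ∞ φ) : ContDiff ℝ 1 (profile e φ) :=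
  (hφ.of_le (by exact_mod_cast le_top)).comp (contDiff_id.smul contDiff_const)

theorem exists_profile_eq_zero {e : EuclideanSpace ℝ (Fin N)} (he : ‖e‖ = 1)
    {φ : EuclideanSpace ℝ (Fin N) → ℝ} (hφ : HasCompactSupport φ) :
    ∃ T, ∀ r, T ≤ r → profile e φ r = 0 := by
  obtain ⟨T, hT⟩ := hφ.isCompact.isBounded.subset_ball 0
  refine ⟨T, fun r hr => ?_⟩
  by_contra hne
  have hmem := hT (subset_tsupport φ hne)
  rw [mem_ball_zero_iff, norm_smul, he, mul_one] at hmem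
  exact absurd ((le_abs_self r).trans_lt hmem) (not_lt.2 hr)

theorem apply_eq_profile {e : EuclideanSpace ℝ (Fin N)} (he : ‖e‖ = 1)
    {φ : EuclideanSpace ℝ (Fin N) → ℝ} (hφ : ∀ x y, ‖x‖ = ‖y‖ → φ x = φ y)
    (x : EuclideanSpace ℝ (Fin N)) : φ x = profile e φ ‖x‖ :=
  hφ _ _ (by simp [norm_smul, he])

/-- By radiality the ray through `e` may be replaced by the ray through `x`; the derivative of the
profile is then a directional derivative of `φ` along a unit vector. -/
theorem abs_deriv_profile_le {e : EuclideanSpace ℝ (Fin N)} (he : ‖e‖ = 1)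
    {φ : EuclideanSpace ℝ (Fin N) → ℝ} (hd : ContDiff ℝ ∞ φ)
    (hφ : ∀ x y, ‖x‖ = ‖y‖ → φ x = φ y) {x : EuclideanSpace ℝ (Fin N)} (hx : x ≠ 0) :
    |deriv (profile e φ) ‖x‖| ≤ ‖∇ φ x‖ := by
  have hx' : 0 < ‖x‖ := norm_pos_iff.2 hx
  set v := ‖x‖⁻¹ • x with hv
  have hvn : ‖v‖ = 1 := by rw [hv, norm_smul, norm_inv, norm_norm, inv_mul_cancel₀ hx'.ne']
  have hxv : ‖x‖ • v = x := by rw [hv, smul_smul, mul_inv_cancel₀ hx'.ne', one_smul]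
  have heq : profile e φ = profile v φ := by
    funext t
    exact hφ _ _ (by simp [norm_smul, he, hvn])
  have hdv : HasDerivAt (profile v φ) (fderiv ℝ φ x v) ‖x‖ := by
    have h1 : HasFDerivAt φ (fderiv ℝ φ x) (‖x‖ • v) := by
      rw [hxv]
      exact (hd.differentiable (by simp) x).hasFDerivAt
    have h2 : HasDerivAt (fun t : ℝ => t • v) v ‖x‖ := by
      simpa using (hasDerivAt_id ‖x‖).smul_const v
    exact h1.comp_hasDerivAt _ h2
  rw [heq, hdv.deriv, ← Real.norm_eq_abs]
  refine ((fderiv ℝ φ x).le_opNorm v).trans ?_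
  rw [hvn, mul_one, gradient, LinearIsometryEquiv.norm_map]

/-- The weighted energy of a function on the half line. -/
noncomputable def energy (w : ℝ → ℝ) (p : ℝ) (f : ℝ → ℝ) : ℝ≥0∞ :=
  ∫⁻ t in Ioi (0 : ℝ), ENNReal.ofReal (w t * |deriv f t| ^ p)

theorem energy_profile_le (hN : 0 < N) {A : ℝ → ℝ} {p : ℝ} (hp : 0 < p)
    (hA : ContinuousOn A (Ioi 0)) (hA0 : ∀ r, 0 < r → 0 < A r)
    {e : EuclideanSpace ℝ (Fin N)} (he : ‖e‖ = 1)
    {φ : EuclideanSpace ℝ (Fin N) → ℝ} (hd : ContDiff ℝ ∞ φ)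
    (hφ : ∀ x y, ‖x‖ = ‖y‖ → φ x = φ y) :
    (volume : Measure (EuclideanSpace ℝ (Fin N))).toSphere univ *
      energy (fun t => A t * t ^ (N - 1)) p (profile e φ) ≤ normA A p φ ^ p := by
  have : Nonempty (Fin N) := ⟨⟨0, hN⟩⟩
  have hder : Continuous (deriv (profile e φ)) := (contDiff_profile e hd).continuous_deriv le_rfl
  have hm : AEMeasurable (fun t => ENNReal.ofReal (A t * |deriv (profile e φ) t| ^ p))
      (volume.restrict (Ioi 0)) :=
    ((hA.aemeasurable measurableSet_Ioi).mul
      (hder.abs.measurable.pow_const p).aemeasurable).ennreal_ofReal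
  have h := lintegral_comp_norm (volume : Measure (EuclideanSpace ℝ (Fin N))) hm
  rw [finrank_euclideanSpace_fin] at h
  have henergy : energy (fun t => A t * t ^ (N - 1)) p (profile e φ) =
      ∫⁻ t in Ioi (0 : ℝ), ENNReal.ofReal (t ^ (N - 1)) *
        ENNReal.ofReal (A t * |deriv (profile e φ) t| ^ p) := by
    refine setLIntegral_congr_fun measurableSet_Ioi fun t ht => ?_
    have ht' : (0 : ℝ) < t := ht
    simp only
    rw [← ENNReal.ofReal_mul (by positivity)]
    congr 1
    ring
  rw [henergy, ← h, normA, ← ENNReal.rpow_mul, one_div_mul_cancel hp.ne', ENNReal.rpow_one]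
  refine lintegral_mono_ae ?_
  have h0 : ∀ᵐ x : EuclideanSpace ℝ (Fin N), x ≠ 0 := by
    simp [ae_iff]
  filter_upwards [h0] with x hx
  have := hA0 ‖x‖ (norm_pos_iff.2 hx)
  exact ENNReal.ofReal_le_ofReal (by gcongr; exact abs_deriv_profile_le he hd hφ hx)

end Profile

end RadialQuasilinear

namespace RadialQuasilinear

/-! ### Weighted Hölder estimates on the half line. -/

section HalfLine

variable {w : ℝ → ℝ} {p : ℝ}

/-- The weight `w ^ (-1 / (p - 1))` dual to `w`. -/
noncomputable def dualWeight (w : ℝ → ℝ) (p : ℝ) (t : ℝ) : ℝ := w t ^ (-(1 / (p - 1)))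

/-- The decay majorant `(∫_r^∞ w ^ (-1 / (p - 1))) ^ (1 - 1 / p)`. -/
noncomputable def decay (w : ℝ → ℝ) (p : ℝ) (r : ℝ) : ℝ≥0∞ :=
  (∫⁻ t in Ioi r, ENNReal.ofReal (dualWeight w p t)) ^ (1 - 1 / p)

/-- The factorization that prepares Hölder's inequality with exponents `p` and `p/(p-1)`: the weight
`c` goes into the first factor and its dual power compensates in the second. -/
theorem mul_eq_rpow_mul_rpow (hp : 1 < p) {a b c : ℝ} (ha : 0 ≤ a) (hb : 0 ≤ b) (hc : 0 < c) :
    a * b = (c * a ^ p) ^ (1 / p) * (b ^ (p / (p - 1)) * c ^ (-(1 / (p - 1)))) ^ (1 - 1 / p) := by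
  have hp0 : p ≠ 0 := by linarith
  have hp1 : p - 1 ≠ 0 := by linarith
  rw [Real.mul_rpow hc.le (by positivity), Real.mul_rpow (by positivity) (by positivity),
    ← Real.rpow_mul ha, ← Real.rpow_mul hb, ← Real.rpow_mul hc.le,
    show p * (1 / p) = 1 by field_simp,
    show p / (p - 1) * (1 - 1 / p) = 1 by field_simp,
    show -(1 / (p - 1)) * (1 - 1 / p) = -(1 / p) by field_simp,
    Real.rpow_one, Real.rpow_one, Real.rpow_neg hc.le]
  have : c ^ (1 / p) ≠ 0 := (Real.rpow_pos_of_pos hc _).ne'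
  field_simp

theorem aemeasurable_dualWeight (hw : ContinuousOn w (Ioi 0)) :
    AEMeasurable (dualWeight w p) (volume.restrict (Ioi 0)) :=
  (hw.aemeasurable measurableSet_Ioi).pow_const _

theorem lintegral_deriv_mul_le (hp : 1 < p) (hw : ContinuousOn w (Ioi 0))
    (hw0 : ∀ t, 0 < t → 0 < w t) {f g : ℝ → ℝ} (hf : ContDiff ℝ 1 f) (hg : Measurable g)
    {S : Set ℝ} (hS : MeasurableSet S) (hS0 : S ⊆ Ioi 0) :
    ∫⁻ t in S, ENNReal.ofReal (|deriv f t| * |g t|) ≤ energy w p f ^ (1 / p) *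
      (∫⁻ t in S, ENNReal.ofReal (|g t| ^ (p / (p - 1)) * dualWeight w p t)) ^ (1 - 1 / p) := by
  have hp0 : 0 < p := by linarith
  have h1p : 1 / p ≤ 1 := by rw [div_le_one hp0]; exact hp.le
  have hder : Measurable (deriv f) := (hf.continuous_deriv le_rfl).measurable
  have hmono : volume.restrict S ≤ volume.restrict (Ioi (0 : ℝ)) := Measure.restrict_mono_set _ hS0
  have hm1 : AEMeasurable (fun t => ENNReal.ofReal (w t * |deriv f t| ^ p))
      (volume.restrict S) :=
    (((hw.aemeasurable measurableSet_Ioi).mono_measure hmono).mul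
      (hder.abs.pow_const p).aemeasurable).ennreal_ofReal
  have hm2 : AEMeasurable (fun t => ENNReal.ofReal (|g t| ^ (p / (p - 1)) * dualWeight w p t))
      (volume.restrict S) :=
    ((hg.abs.pow_const _).aemeasurable.mul
      ((aemeasurable_dualWeight hw).mono_measure hmono)).ennreal_ofReal
  calc
    ∫⁻ t in S, ENNReal.ofReal (|deriv f t| * |g t|)
      = ∫⁻ t in S, ENNReal.ofReal (w t * |deriv f t| ^ p) ^ (1 / p) *
          ENNReal.ofReal (|g t| ^ (p / (p - 1)) * dualWeight w p t) ^ (1 - 1 / p) := by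
        refine setLIntegral_congr_fun hS fun t ht => ?_
        have hwt := hw0 t (hS0 ht)
        have hd : 0 ≤ dualWeight w p t := Real.rpow_nonneg hwt.le _
        rw [mul_eq_rpow_mul_rpow hp (abs_nonneg (deriv f t)) (abs_nonneg (g t)) hwt,
          ENNReal.ofReal_mul (by positivity),
          ENNReal.ofReal_rpow_of_nonneg (by positivity) (by positivity),
          ENNReal.ofReal_rpow_of_nonneg (by positivity) (by linarith), dualWeight]
    _ ≤ (∫⁻ t in S, ENNReal.ofReal (w t * |deriv f t| ^ p)) ^ (1 / p) *
          (∫⁻ t in S, ENNReal.ofReal (|g t| ^ (p / (p - 1)) * dualWeight w p t)) ^ (1 - 1 / p) :=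
        ENNReal.lintegral_mul_norm_pow_le hm1 hm2 (by positivity) (by linarith) (by ring)
    _ ≤ _ := by
        gcongr
        exact lintegral_mono_set hS0

/-- The radial lemma: a function with compact support is bounded by its energy. -/
theorem enorm_le_energy_mul_decay (hp : 1 < p) (hw : ContinuousOn w (Ioi 0))
    (hw0 : ∀ t, 0 < t → 0 < w t) {f : ℝ → ℝ} (hf : ContDiff ℝ 1 f)
    (hf0 : ∃ T, ∀ t, T ≤ t → f t = 0) {r : ℝ} (hr : 0 < r) :
    ‖f r‖ₑ ≤ energy w p f ^ (1 / p) * decay w p r := by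
  obtain ⟨T, hT⟩ := hf0
  have h := enorm_sub_le_lintegral_deriv_of_contDiffOn_Icc (hf.contDiffOn (s := Icc r (max r T)))
    (le_max_left _ _)
  rw [hT _ (le_max_right _ _), zero_sub, enorm_neg] at h
  refine h.trans ?_
  have h2 := lintegral_deriv_mul_le hp hw hw0 hf (measurable_const (a := (1 : ℝ)))
    (measurableSet_Ioi (a := r)) (Ioi_subset_Ioi hr.le)
  simp only [abs_one, mul_one, Real.one_rpow, one_mul] at h2
  refine le_trans ?_ h2
  rw [setLIntegral_congr (Ioc_ae_eq_Icc (a := r)).symm]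
  simp only [Real.enorm_eq_ofReal_abs]
  exact lintegral_mono_set Ioc_subset_Ioi_self

/-- Since `p > 1`, `|f|^p` is `C¹` with derivative bounded by `p |f|^(p-1) |f'|`; Hölder's
inequality with `g = |f|^(p-1)` turns `|g|^(p/(p-1))` back into `|f|^p`. -/
theorem enorm_rpow_sub_rpow_le (hp : 1 < p) (hw : ContinuousOn w (Ioi 0))
    (hw0 : ∀ t, 0 < t → 0 < w t) {f : ℝ → ℝ} (hf : ContDiff ℝ 1 f) {s r : ℝ} (hs : 0 < s)
    (hsr : s ≤ r) :
    ‖|f r| ^ p - |f s| ^ p‖ₑ ≤ ENNReal.ofReal p * (energy w p f ^ (1 / p) *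
      (∫⁻ t in Icc s r, ENNReal.ofReal (|f t| ^ p * dualWeight w p t)) ^ (1 - 1 / p)) := by
  have hF : ContDiff ℝ 1 fun t => |f t| ^ p := by
    simpa only [Real.norm_eq_abs] using hf.norm_rpow hp
  refine (enorm_sub_le_lintegral_deriv_of_contDiffOn_Icc hF.contDiffOn hsr).trans ?_
  have h2 := lintegral_deriv_mul_le hp hw hw0 hf
    (g := fun t => |f t| ^ (p - 1)) (hf.continuous.measurable.abs.pow_const _)
    (measurableSet_Icc (a := s) (b := r)) (fun t ht => lt_of_lt_of_le hs ht.1)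
  have h3 : ∀ t, |(|f t| ^ (p - 1))| ^ (p / (p - 1)) = |f t| ^ p := fun t => by
    have : p - 1 ≠ 0 := by linarith
    rw [abs_of_nonneg (by positivity), ← Real.rpow_mul (abs_nonneg _)]
    congr 1
    field_simp
  simp only [h3] at h2
  refine le_trans ?_ (mul_le_mul_right h2 _)
  rw [← lintegral_const_mul' _ _ ENNReal.ofReal_ne_top]
  refine lintegral_mono fun t => ?_
  rw [← ENNReal.ofReal_mul (by linarith), Real.enorm_eq_ofReal_abs]
  refine ENNReal.ofReal_le_ofReal ?_
  have h4 := norm_fderiv_norm_rpow_le (hf.differentiable one_ne_zero) (x := t) hp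
  simp only [Real.norm_eq_abs, ← norm_deriv_eq_norm_fderiv] at h4
  refine h4.trans (le_of_eq ?_)
  rw [abs_of_nonneg (a := |f t| ^ (p - 1)) (by positivity)]
  ring

end HalfLine

end RadialQuasilinear

namespace RadialQuasilinear

/-! ### Passage to limits of Cauchy sequences of profiles. -/

section RadialLimit

variable {w : ℝ → ℝ} {p : ℝ}

/-- The dual weight is continuous on compact intervals, and beyond `T` it is dominated by a multiple
of `t^(-b/(p-1))`, whose exponent is below `-1` because `b > p - 1`. -/
theorem decay_lt_top (hp : 1 < p) (hw : ContinuousOn w (Ioi 0)) (hw0 : ∀ t, 0 < t → 0 < w t)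
    {c b T : ℝ} (hc : 0 < c) (hb : p - 1 < b) (hT : 0 < T) (h : ∀ t, T ≤ t → c * t ^ b ≤ w t)
    {r : ℝ} (hr : 0 < r) : decay w p r < ⊤ := by
  have hp0 : 0 < p := by linarith
  have hp1 : 0 < p - 1 := by linarith
  have h1p : 1 / p ≤ 1 := by rw [div_le_one hp0]; exact hp.le
  refine ENNReal.rpow_lt_top_of_nonneg (by linarith) (ne_of_lt ?_)
  have hcont : ContinuousOn (dualWeight w p) (Ioi 0) := fun t ht =>
    (hw t ht).rpow_const (Or.inl (hw0 t ht).ne')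
  have hI1 : IntegrableOn (dualWeight w p) (Icc r (max r T)) :=
    (hcont.mono fun t ht => hr.trans_le ht.1).integrableOn_compact isCompact_Icc
  have hI2 : IntegrableOn (dualWeight w p) (Ioi T) := by
    have hdom : IntegrableOn (fun t : ℝ => c ^ (-(1 / (p - 1))) * t ^ (b * -(1 / (p - 1))))
        (Ioi T) := by
      refine (integrableOn_Ioi_rpow_of_lt ?_ hT).const_mul _
      rw [mul_neg, neg_lt_neg_iff, mul_one_div, one_lt_div hp1]
      exact hb
    refine hdom.mono' ((aemeasurable_dualWeight hw).mono_measure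
      (Measure.restrict_mono_set _ (Ioi_subset_Ioi hT.le))).aestronglyMeasurable ?_
    refine (ae_restrict_iff' measurableSet_Ioi).2 (ae_of_all _ fun t ht => ?_)
    have ht0 : 0 < t := hT.trans ht
    have hd : 0 ≤ dualWeight w p t := Real.rpow_nonneg (hw0 t ht0).le _
    rw [Real.norm_of_nonneg hd, Real.rpow_mul ht0.le, ← Real.mul_rpow hc.le (by positivity)]
    exact Real.rpow_le_rpow_of_nonpos (by positivity) (h t (le_of_lt ht))
      (by simpa using hp1.le)
  have hI : IntegrableOn (dualWeight w p) (Ioi r) := by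
    refine (hI1.union hI2).mono_set fun t ht => ?_
    rcases le_or_gt t (max r T) with h1 | h1
    · exact Or.inl ⟨le_of_lt ht, h1⟩
    · exact Or.inr ((le_max_right _ _).trans_lt h1)
  exact hI.lintegral_lt_top

/-- The estimates inherited by the limits on `(0, ∞)` of functions whose energy is bounded
by `B ^ p`. -/
structure IsRadialLimit (w : ℝ → ℝ) (p : ℝ) (B : ℝ≥0∞) (h : ℝ → ℝ) : Prop where
  aemeasurable : AEMeasurable h (volume.restrict (Ioi 0))
  enorm_le : ∀ r, 0 < r → ‖h r‖ₑ ≤ B * decay w p r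
  enorm_sub_le : ∀ s r, 0 < s → s ≤ r → ‖|h r| ^ p - |h s| ^ p‖ₑ ≤ ENNReal.ofReal p *
    (B * (∫⁻ t in Icc s r, ENNReal.ofReal (|h t| ^ p * dualWeight w p t)) ^ (1 - 1 / p))

theorem isRadialLimit_of_tendsto (hp : 1 < p) (hw : ContinuousOn w (Ioi 0))
    (hw0 : ∀ t, 0 < t → 0 < w t) (hdecay : ∀ r, 0 < r → decay w p r < ⊤)
    {f : ℕ → ℝ → ℝ} (hf : ∀ n, ContDiff ℝ 1 (f n)) (hf0 : ∀ n, ∃ T, ∀ t, T ≤ t → f n t = 0)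
    {B : ℝ≥0∞} (hB : B < ⊤) (hfB : ∀ᶠ n in atTop, energy w p (f n) ^ (1 / p) ≤ B)
    {h : ℝ → ℝ} (hh : ∀ r, 0 < r → Tendsto (fun n => f n r) atTop (𝓝 (h r))) :
    IsRadialLimit w p B h := by
  have hp0 : 0 < p := by linarith
  have h1p : 1 / p < 1 := by rw [div_lt_one hp0]; exact hp
  have hbd : ∀ᶠ n in atTop, ∀ r, 0 < r → ‖f n r‖ₑ ≤ B * decay w p r := by
    filter_upwards [hfB] with n hn r hr
    exact (enorm_le_energy_mul_decay hp hw hw0 (hf n) (hf0 n) hr).trans (by gcongr)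
  refine ⟨aemeasurable_of_tendsto_metrizable_ae atTop
    (fun n => (hf n).continuous.measurable.aemeasurable)
    ((ae_restrict_iff' measurableSet_Ioi).2 (ae_of_all _ hh)), fun r hr => ?_,
    fun s r hs hsr => ?_⟩
  · exact le_of_tendsto (hh r hr).enorm (hbd.mono fun n hn => hn r hr)
  · have hpow : ∀ t, 0 < t → Tendsto (fun n => |f n t| ^ p) atTop (𝓝 (|h t| ^ p)) :=
      fun t ht => ((hh t ht).abs).rpow_const (Or.inr hp0.le)
    have hmono : volume.restrict (Icc s r) ≤ volume.restrict (Ioi (0 : ℝ)) :=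
      Measure.restrict_mono_set _ fun t ht => hs.trans_le ht.1
    have hint : Tendsto
        (fun n => ∫⁻ t in Icc s r, ENNReal.ofReal (|f n t| ^ p * dualWeight w p t)) atTop
        (𝓝 (∫⁻ t in Icc s r, ENNReal.ofReal (|h t| ^ p * dualWeight w p t))) := by
      -- The decay majorant at `s / 2` dominates all values on `[s, r]`, and its finiteness also
      -- makes the dual weight integrable there, since `[s, r]` lies in `(s / 2, ∞)`.
      refine tendsto_lintegral_filter_of_dominated_convergence'
        (fun t => (B * decay w p (s / 2)) ^ p * ENNReal.ofReal (dualWeight w p t)) ?_ ?_ ?_ ?_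
      · refine Eventually.of_forall fun n => ?_
        exact (((hf n).continuous.measurable.abs.pow_const p).aemeasurable.mul
          ((aemeasurable_dualWeight hw).mono_measure hmono)).ennreal_ofReal
      · filter_upwards [hbd] with n hn
        refine (ae_restrict_iff' measurableSet_Icc).2 (ae_of_all _ fun t ht => ?_)
        have ht0 : 0 < t := hs.trans_le ht.1
        rw [ENNReal.ofReal_mul (by positivity), ← ENNReal.ofReal_rpow_of_nonneg (abs_nonneg _)
          hp0.le, ← Real.enorm_eq_ofReal_abs]
        gcongr
        refine (hn t ht0).trans ?_
        unfold decay
        gcongr 2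
        · exact lintegral_mono_set (Ioi_subset_Ioi (by linarith [ht.1]))
      · have hlt : ∫⁻ t in Icc s r, ENNReal.ofReal (dualWeight w p t) < ⊤ := by
          refine lt_of_le_of_lt (lintegral_mono_set (t := Ioi (s / 2)) fun t ht => ?_) ?_
          · exact lt_of_lt_of_le (by linarith) ht.1
          · exact (ENNReal.rpow_lt_top_iff_of_pos (by linarith)).1 (hdecay _ (half_pos hs))
        rw [lintegral_const_mul'']
        · exact (ENNReal.mul_lt_top (ENNReal.rpow_lt_top_of_nonneg hp0.le
            (ENNReal.mul_lt_top hB (hdecay _ (half_pos hs))).ne) hlt).ne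
        · exact ((aemeasurable_dualWeight hw).mono_measure hmono).ennreal_ofReal
      · refine (ae_restrict_iff' measurableSet_Icc).2 (ae_of_all _ fun t ht => ?_)
        exact ENNReal.tendsto_ofReal ((hpow t (hs.trans_le ht.1)).mul_const _)
    have hrhs := ENNReal.Tendsto.const_mul (a := ENNReal.ofReal p)
      (ENNReal.Tendsto.const_mul (a := B) (hint.ennrpow_const (1 - 1 / p))
      (Or.inr hB.ne)) (Or.inr ENNReal.ofReal_ne_top)
    refine le_of_tendsto_of_tendsto ((hpow r (hs.trans_le hsr)).sub (hpow s hs)).enorm hrhs ?_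
    filter_upwards [hfB] with n hn
    refine (enorm_rpow_sub_rpow_le hp hw hw0 (hf n) hs hsr).trans ?_
    gcongr

/-- The radial lemma applied to differences makes the sequence Cauchy at each radius. The limit thus
exists at every `r > 0`, so the later pointwise estimates need no exceptional set of radii. -/
theorem exists_tendsto_of_cauchy (hp : 1 < p) (hw : ContinuousOn w (Ioi 0))
    (hw0 : ∀ t, 0 < t → 0 < w t) (hdecay : ∀ r, 0 < r → decay w p r < ⊤)
    {f : ℕ → ℝ → ℝ} (hf : ∀ n, ContDiff ℝ 1 (f n)) (hf0 : ∀ n, ∃ T, ∀ t, T ≤ t → f n t = 0)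
    (hC : Tendsto (fun k : ℕ × ℕ => energy w p (f k.1 - f k.2) ^ (1 / p)) atTop (𝓝 0)) :
    ∃ h : ℝ → ℝ, ∀ r, 0 < r → Tendsto (fun n => f n r) atTop (𝓝 (h r)) := by
  have key : ∀ r, ∃ y, 0 < r → Tendsto (fun n => f n r) atTop (𝓝 y) := by
    intro r
    rcases le_or_gt r 0 with hr | hr
    · exact ⟨0, fun h => absurd h (not_lt.2 hr)⟩
    have hcs : CauchySeq fun n => f n r := by
      have h1 := ENNReal.Tendsto.mul_const (b := decay w p r) hC (Or.inr (hdecay r hr).ne)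
      rw [zero_mul] at h1
      refine EMetric.cauchySeq_iff.2 fun ε hε => ?_
      obtain ⟨M, hM⟩ := eventually_atTop.1 ((tendsto_order.1 h1).2 ε hε)
      refine ⟨max M.1 M.2, fun m hm n hn => lt_of_le_of_lt ?_ (hM (m, n)
        ⟨(le_max_left _ _).trans hm, (le_max_right _ _).trans hn⟩)⟩
      rw [edist_eq_enorm_sub]
      have hz : ∃ T, ∀ t, T ≤ t → (f m - f n) t = 0 := by
        obtain ⟨T, hT⟩ := hf0 m
        obtain ⟨T', hT'⟩ := hf0 n
        refine ⟨max T T', fun t ht => ?_⟩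
        simp [hT t ((le_max_left _ _).trans ht), hT' t ((le_max_right _ _).trans ht)]
      exact enorm_le_energy_mul_decay hp hw hw0 ((hf m).sub (hf n)) hz hr
    obtain ⟨y, hy⟩ := cauchySeq_tendsto_of_complete hcs
    exact ⟨y, fun _ => hy⟩
  choose h hh using key
  exact ⟨h, hh⟩

end RadialLimit

end RadialQuasilinear

namespace RadialQuasilinear

/-! ### The pointwise bound near the origin. -/

section Pointwise

variable {w : ℝ → ℝ} {p : ℝ}

/-- Splits off the power `t^σ` for which an integral bound on `t^σ |f|^p` is available; the
remaining power is estimated by its supremum. -/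
theorem dualWeight_le (hp : 1 < p) {c b : ℝ} (σ : ℝ) {t : ℝ} (hc : 0 < c) (ht : 0 < t)
    (h : c * t ^ b ≤ w t) : dualWeight w p t ≤
      c ^ (-(1 / (p - 1))) * (t ^ σ * t ^ (-((b + (p - 1) * σ) / (p - 1)))) := by
  have hp1 : 0 < p - 1 := by linarith
  rw [← Real.rpow_add ht,
    show σ + -((b + (p - 1) * σ) / (p - 1)) = b * -(1 / (p - 1)) by field_simp; ring,
    Real.rpow_mul ht.le, ← Real.mul_rpow hc.le (by positivity)]
  exact Real.rpow_le_rpow_of_nonpos (by positivity) h (by simpa using hp1.le)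

/-- The point `τ` is to be an endpoint at which the remaining power `t^(-pm/(p-1))` is largest: the
left one if `m ≥ 0`, the right one if `m ≤ 0`. -/
theorem lintegral_dualWeight_rpow_le (hp : 1 < p) {c b σ ρ m : ℝ} (hc : 0 < c)
    (hm : m = (b + (p - 1) * σ) / p) (h : ∀ t, 0 < t → t ≤ ρ → c * t ^ b ≤ w t) {M : ℝ≥0∞}
    {f : ℝ → ℝ} (hM : ∫⁻ t in Ioc 0 ρ, ENNReal.ofReal (t ^ σ * |f t| ^ p) ≤ M) {s r τ : ℝ}
    (hs : 0 < s) (hr : r ≤ ρ) (hτ : 0 < τ)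
    (hsτ : ∀ t ∈ Icc s r, t ^ (-(p * m / (p - 1))) ≤ τ ^ (-(p * m / (p - 1)))) :
    (∫⁻ t in Icc s r, ENNReal.ofReal (|f t| ^ p * dualWeight w p t)) ^ (1 - 1 / p) ≤
      (ENNReal.ofReal (c ^ (-(1 / (p - 1)))) * M) ^ (1 - 1 / p) * ENNReal.ofReal (τ ^ (-m)) := by
  have hp0 : 0 < p := by linarith
  have hp1 : 0 < p - 1 := by linarith
  have h1p : 1 / p ≤ 1 := by rw [div_le_one hp0]; exact hp.le
  have hpm : b + (p - 1) * σ = p * m := by rw [hm]; field_simp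
  have hτm : ENNReal.ofReal (τ ^ (-m)) =
      ENNReal.ofReal (τ ^ (-(p * m / (p - 1)))) ^ (1 - 1 / p) := by
    rw [ENNReal.ofReal_rpow_of_nonneg (by positivity) (by linarith), ← Real.rpow_mul hτ.le]
    congr 2
    field_simp
  rw [hτm, ← ENNReal.mul_rpow_of_nonneg _ _ (by linarith)]
  refine ENNReal.rpow_le_rpow ?_ (by linarith)
  rw [mul_right_comm, ← ENNReal.ofReal_mul (by positivity)]
  refine le_trans ?_ (mul_le_mul_right hM _)
  rw [← lintegral_const_mul' _ _ ENNReal.ofReal_ne_top]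
  refine (setLIntegral_mono' measurableSet_Icc fun t ht => ?_).trans
    (lintegral_mono_set fun t ht => ⟨hs.trans_le ht.1, ht.2.trans hr⟩)
  have ht0 : 0 < t := hs.trans_le ht.1
  rw [← ENNReal.ofReal_mul (by positivity)]
  refine ENNReal.ofReal_le_ofReal ?_
  have h1 := dualWeight_le hp σ hc ht0 (h t ht0 (ht.2.trans hr))
  rw [hpm] at h1
  calc |f t| ^ p * dualWeight w p t
      ≤ |f t| ^ p * (c ^ (-(1 / (p - 1))) * (t ^ σ * τ ^ (-(p * m / (p - 1))))) := by
        refine mul_le_mul_of_nonneg_left (h1.trans ?_) (by positivity)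
        have := hsτ t ht
        gcongr
    _ = _ := by ring

theorem lintegral_rpow_Ioc_eq_top {σ r : ℝ} (hσ : σ ≤ -1) (hr : 0 < r) :
    ∫⁻ t in Ioc 0 r, ENNReal.ofReal (t ^ σ) = ⊤ := by
  by_contra hne
  have hint : IntegrableOn (fun t : ℝ => t ^ σ) (Ioo 0 r) := by
    refine IntegrableOn.mono_set (t := Ioc 0 r) ⟨by fun_prop, ?_⟩ Ioo_subset_Ioc_self
    rw [hasFiniteIntegral_iff_norm]
    refine lt_of_le_of_lt (le_of_eq ?_) (lt_top_iff_ne_top.2 hne)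
    refine setLIntegral_congr_fun measurableSet_Ioc fun t ht => ?_
    have ht0 : 0 < t := ht.1
    rw [Real.norm_of_nonneg (by positivity)]
  rw [intervalIntegral.integrableOn_Ioo_rpow_iff hr] at hint
  linarith

theorem IsRadialLimit.ofReal_rpow_le {B : ℝ≥0∞} {f : ℝ → ℝ} (hf : IsRadialLimit w p B f)
    (hp : 1 < p) {c b σ ρ m : ℝ} (hc : 0 < c) (hρ : 0 < ρ) (hm : m = (b + (p - 1) * σ) / p)
    (hmσ : 0 ≤ m ∨ m ≤ 0 ∧ σ ≤ -1) (h : ∀ t, 0 < t → t ≤ ρ → c * t ^ b ≤ w t) {M : ℝ≥0∞}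
    (hMtop : M < ⊤) (hM : ∫⁻ t in Ioc 0 ρ, ENNReal.ofReal (t ^ σ * |f t| ^ p) ≤ M) {r : ℝ}
    (hr : 0 < r) (hrρ : r ≤ ρ) :
    ENNReal.ofReal (|f r| ^ p) ≤
      ((B * decay w p ρ) ^ p * ENNReal.ofReal (ρ ^ m) + ENNReal.ofReal p *
        (B * (ENNReal.ofReal (c ^ (-(1 / (p - 1)))) * M) ^ (1 - 1 / p))) *
      ENNReal.ofReal (r ^ (-m)) := by
  have hp0 : 0 < p := by linarith
  have hp1 : 0 < p - 1 := by linarith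
  have hsub : ∀ x y : ℝ, 0 ≤ y → ENNReal.ofReal x ≤ ENNReal.ofReal y + ‖x - y‖ₑ := by
    intro x y hy
    rw [Real.enorm_eq_ofReal_abs, ← ENNReal.ofReal_add hy (abs_nonneg _)]
    exact ENNReal.ofReal_le_ofReal (by linarith [le_abs_self (x - y)])
  rcases hmσ with hm0 | ⟨hm0, hσ⟩
  · have h1 := hf.enorm_sub_le r ρ hr hrρ
    have h2 := lintegral_dualWeight_rpow_le hp hc hm h hM hr le_rfl hr fun t ht =>
      Real.rpow_le_rpow_of_nonpos hr ht.1 (by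
        rw [neg_nonpos]; positivity)
    have h3 := hsub (|f r| ^ p) (|f ρ| ^ p) (by positivity)
    rw [← enorm_neg, neg_sub] at h3
    have h4 : ENNReal.ofReal (|f ρ| ^ p) ≤
        (B * decay w p ρ) ^ p * ENNReal.ofReal (ρ ^ m) * ENNReal.ofReal (r ^ (-m)) := by
      rw [← ENNReal.ofReal_rpow_of_nonneg (abs_nonneg _) hp0.le, ← Real.enorm_eq_ofReal_abs,
        mul_assoc, ← ENNReal.ofReal_mul (by positivity)]
      -- As `(ρ/r)^m ≥ 1`, the boundary value at `ρ` is absorbed into the term in `r^(-m)`.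
      have h5 : 1 ≤ ENNReal.ofReal (ρ ^ m * r ^ (-m)) := by
        rw [ENNReal.one_le_ofReal, Real.rpow_neg hr.le, ← div_eq_mul_inv,
          ← Real.div_rpow hρ.le hr.le]
        exact Real.one_le_rpow ((one_le_div hr).2 hrρ) hm0
      calc ‖f ρ‖ₑ ^ p ≤ (B * decay w p ρ) ^ p := by
            gcongr; exact hf.enorm_le ρ hρ
        _ ≤ _ := le_mul_of_one_le_right zero_le h5
    rw [add_mul]
    refine h3.trans (add_le_add h4 (h1.trans ?_))
    rw [mul_assoc, mul_assoc]
    gcongr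
  · rw [add_mul]
    refine le_trans ?_ (le_add_of_nonneg_left zero_le)
    set X := ENNReal.ofReal p *
        (B * (ENNReal.ofReal (c ^ (-(1 / (p - 1)))) * M) ^ (1 - 1 / p)) *
        ENNReal.ofReal (r ^ (-m)) with hX
    have h1 : ∀ s, 0 < s → s ≤ r →
        ENNReal.ofReal (|f r| ^ p) ≤ ENNReal.ofReal (|f s| ^ p) + X := by
      intro s hs hsr
      refine (hsub _ (|f s| ^ p) (by positivity)).trans ?_
      gcongr
      refine (hf.enorm_sub_le s r hs hsr).trans ?_
      have h2 := lintegral_dualWeight_rpow_le hp hc hm h hM hs hrρ hr fun t ht =>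
        Real.rpow_le_rpow (hs.le.trans ht.1) ht.2 (by
          rw [neg_nonneg]
          exact div_nonpos_of_nonpos_of_nonneg (mul_nonpos_of_nonneg_of_nonpos hp0.le hm0) hp1.le)
      rw [hX, mul_assoc, mul_assoc]
      gcongr
    -- If the bound failed by some `δ > 0`, then `|f(s)|^p ≥ δ` on all of `(0, r]`; as `t^σ` is not
    -- integrable at the origin for `σ ≤ -1`, this contradicts the finiteness of `M`.
    by_contra! hlt
    have hδ : ENNReal.ofReal (|f r| ^ p) - X ≠ 0 := (tsub_pos_of_lt hlt).ne'
    have h2 : ∫⁻ t in Ioc 0 r, ENNReal.ofReal (t ^ σ) * (ENNReal.ofReal (|f r| ^ p) - X) ≤ M := by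
      refine le_trans ?_ ((lintegral_mono_set (Ioc_subset_Ioc_right hrρ)).trans hM)
      refine setLIntegral_mono' measurableSet_Ioc fun t ht => ?_
      have ht0 : 0 < t := ht.1
      rw [ENNReal.ofReal_mul (by positivity)]
      gcongr
      exact tsub_le_iff_right.2 (h1 t ht.1 ht.2)
    rw [lintegral_mul_const _ (by fun_prop), lintegral_rpow_Ioc_eq_top hσ hr,
      ENNReal.top_mul hδ] at h2
    exact absurd hMtop (not_lt.2 h2)

end Pointwise

end RadialQuasilinear

namespace RadialQuasilinear

/-! ### Power bounds extracted from the hypotheses on the weights. -/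

section WeightBounds

theorem eventually_mul_rpow_le {A : ℝ → ℝ} {a : ℝ} {l : Filter ℝ} (hl : ∀ᶠ t in l, 0 < t)
    (h : ∃ c₀ : ℝ, 0 < c₀ ∧ (c₀ : EReal) ≤ liminf (fun r : ℝ => ((A r / r ^ a : ℝ) : EReal)) l) :
    ∃ c : ℝ, 0 < c ∧ ∀ᶠ t in l, c * t ^ a ≤ A t := by
  obtain ⟨c, hc, hle⟩ := h
  -- Halving makes the comparison with the lower limit strict, as an eventual bound requires.
  refine ⟨c / 2, half_pos hc, ?_⟩
  have hlt : ((c / 2 : ℝ) : EReal) < liminf (fun r : ℝ => ((A r / r ^ a : ℝ) : EReal)) l :=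
    lt_of_lt_of_le (EReal.coe_lt_coe_iff.2 (half_lt_self hc)) hle
  filter_upwards [hl, eventually_lt_of_lt_liminf hlt] with t ht h1
  rw [EReal.coe_lt_coe_iff, lt_div_iff₀ (Real.rpow_pos_of_pos ht a)] at h1
  exact h1.le

variable {N : ℕ} {p a₀ aInf : ℝ} {A : ℝ → ℝ}

theorem rpow_mul_pow_pred (hN : 0 < N) (a : ℝ) {t : ℝ} (ht : 0 < t) :
    t ^ (a + N - 1) = t ^ a * t ^ (N - 1) := by
  rw [← Real.rpow_natCast t (N - 1), ← Real.rpow_add ht, Nat.cast_sub hN]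
  congr 1
  push_cast
  ring

theorem HypA.exists_le_near_zero (hA : HypA N p a₀ aInf A) (hN : 0 < N) :
    ∃ c ρ : ℝ, 0 < c ∧ 0 < ρ ∧
      ∀ t, 0 < t → t ≤ ρ → c * t ^ (a₀ + N - 1) ≤ A t * t ^ (N - 1) := by
  obtain ⟨c, hc, h⟩ := eventually_mul_rpow_le (l := 𝓝[>] 0) self_mem_nhdsWithin hA.liminf_zero
  obtain ⟨ρ, hρ, hsub⟩ := mem_nhdsGT_iff_exists_Ioc_subset.1 h
  refine ⟨c, ρ, hc, hρ, fun t ht htρ => ?_⟩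
  rw [rpow_mul_pow_pred hN a₀ ht, ← mul_assoc]
  exact mul_le_mul_of_nonneg_right (hsub ⟨ht, htρ⟩) (by positivity)

theorem HypA.exists_le_near_infty (hA : HypA N p a₀ aInf A) (hN : 0 < N) :
    ∃ c T : ℝ, 0 < c ∧ 0 < T ∧ ∀ t, T ≤ t → c * t ^ (aInf + N - 1) ≤ A t * t ^ (N - 1) := by
  obtain ⟨c, hc, h⟩ := eventually_mul_rpow_le (l := atTop) (eventually_gt_atTop 0) hA.liminf_infty
  obtain ⟨T, hT⟩ := eventually_atTop.1 h
  refine ⟨c, max T 1, hc, by positivity, fun t ht => ?_⟩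
  have ht0 : 0 < t := lt_of_lt_of_le (by positivity) ht
  rw [rpow_mul_pow_pred hN aInf ht0, ← mul_assoc]
  exact mul_le_mul_of_nonneg_right (hT t ((le_max_left _ _).trans ht)) (by positivity)

theorem HypA.continuousOn_weight (hA : HypA N p a₀ aInf A) :
    ContinuousOn (fun t => A t * t ^ (N - 1)) (Ioi 0) :=
  hA.continuousOn.mul (continuous_pow _).continuousOn

theorem HypA.weight_pos (hA : HypA N p a₀ aInf A) (t : ℝ) (ht : 0 < t) :
    0 < A t * t ^ (N - 1) := mul_pos (hA.pos t ht) (by positivity)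

theorem HypA.decay_weight_lt_top (hA : HypA N p a₀ aInf A) (hN : 0 < N) (hp : 1 < p) (r : ℝ)
    (hr : 0 < r) : decay (fun t => A t * t ^ (N - 1)) p r < ⊤ := by
  obtain ⟨c, T, hc, hT, h⟩ := hA.exists_le_near_infty hN
  exact decay_lt_top hp hA.continuousOn_weight hA.weight_pos hc
    (by linarith [hA.mem_infty.1]) hT h hr

theorem exists_rpow_neg_le_of_essInf_pos {V : ℝ → ℝ} {γ R : ℝ}
    (h : 0 < essInf (fun r : ℝ => ENNReal.ofReal (r ^ γ * V r)) (volume.restrict (Ioo 0 R))) :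
    ∃ c : ℝ, 0 < c ∧ ∀ᵐ r ∂(volume.restrict (Ioo 0 R)), c * r ^ (-γ) ≤ V r := by
  obtain ⟨c, hc, hlt⟩ := ENNReal.lt_iff_exists_nnreal_btwn.1 h
  refine ⟨c, by exact_mod_cast hc, ?_⟩
  filter_upwards [ae_lt_of_lt_essInf hlt, ae_restrict_mem measurableSet_Ioo] with r hr hmem
  have hr0 : 0 < r := hmem.1
  have h1 : (c : ℝ) < r ^ γ * V r := (ENNReal.ofReal_lt_ofReal_iff' (p := c)).1
    (by rwa [ENNReal.ofReal_coe_nnreal]) |>.1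
  rw [Real.rpow_neg hr0.le, ← div_eq_mul_inv, div_le_iff₀ (Real.rpow_pos_of_pos hr0 γ)]
  linarith

theorem exists_le_mul_of_essSup_lt_top {K W : ℝ → ℝ} {μ : Measure ℝ}
    (hW : ∀ᵐ r ∂μ, 0 < W r)
    (h : essSup (fun r : ℝ => ENNReal.ofReal (K r) / ENNReal.ofReal (W r)) μ < ⊤) :
    ∃ C : ℝ, 0 ≤ C ∧ ∀ᵐ r ∂μ, K r ≤ C * W r := by
  refine ⟨(essSup (fun r : ℝ => ENNReal.ofReal (K r) / ENNReal.ofReal (W r)) μ).toReal,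
    ENNReal.toReal_nonneg, ?_⟩
  filter_upwards [hW, ENNReal.ae_le_essSup
    (fun r : ℝ => ENNReal.ofReal (K r) / ENNReal.ofReal (W r))] with r hr hle
  rw [ENNReal.div_le_iff (by simpa using hr) ENNReal.ofReal_ne_top,
    ← ENNReal.ofReal_toReal h.ne, ← ENNReal.ofReal_mul ENNReal.toReal_nonneg] at hle
  exact (ENNReal.ofReal_le_ofReal_iff (by positivity)).1 hle

end WeightBounds

/-! ### From the half line back to the space `X`. -/

section Space

variable {N : ℕ} {p a₀ aInf : ℝ} {A V : ℝ → ℝ}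

/-- The surface measure of the unit sphere of `ℝ^N`. -/
noncomputable def sphereMass (N : ℕ) : ℝ≥0∞ :=
  (volume : Measure (EuclideanSpace ℝ (Fin N))).toSphere univ

theorem sphereMass_ne_top : sphereMass N ≠ ⊤ := measure_ne_top _ _

theorem sphereMass_ne_zero (hN : 0 < N) : sphereMass N ≠ 0 := by
  have : Nonempty (Fin N) := ⟨⟨0, hN⟩⟩
  rw [sphereMass, Ne, Measure.measure_univ_eq_zero]
  exact Measure.toSphere_ne_zero volume

theorem lintegral_comp_norm_euclidean (hN : 0 < N) {f : ℝ → ℝ≥0∞}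
    (hf : AEMeasurable f (volume.restrict (Ioi 0))) :
    ∫⁻ x : EuclideanSpace ℝ (Fin N), f ‖x‖ =
      sphereMass N * ∫⁻ t in Ioi (0 : ℝ), ENNReal.ofReal (t ^ (N - 1)) * f t := by
  have : Nonempty (Fin N) := ⟨⟨0, hN⟩⟩
  simpa [sphereMass] using
    lintegral_comp_norm (volume : Measure (EuclideanSpace ℝ (Fin N))) hf

/-- Applied to differences of test functions, this carries the Cauchy property over to the profiles.
-/
theorem energy_profile_rpow_le (hN : 0 < N) (hp : 0 < p) (hA : HypA N p a₀ aInf A)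
    {e : EuclideanSpace ℝ (Fin N)} (he : ‖e‖ = 1)
    {φ : EuclideanSpace ℝ (Fin N) → ℝ} (hd : ContDiff ℝ ∞ φ)
    (hφ : ∀ x y, ‖x‖ = ‖y‖ → φ x = φ y) :
    energy (fun t => A t * t ^ (N - 1)) p (profile e φ) ^ (1 / p) ≤
      (sphereMass N)⁻¹ ^ (1 / p) * normA A p φ := by
  have h := energy_profile_le hN hp hA.continuousOn hA.pos he hd hφ
  have h1 : energy (fun t => A t * t ^ (N - 1)) p (profile e φ) ≤
      (sphereMass N)⁻¹ * normA A p φ ^ p := by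
    rw [mul_comm, ← div_eq_mul_inv, ENNReal.le_div_iff_mul_le
      (Or.inl (sphereMass_ne_zero hN)) (Or.inl sphereMass_ne_top), mul_comm]
    exact h
  refine (ENNReal.rpow_le_rpow h1 (by positivity)).trans (le_of_eq ?_)
  rw [ENNReal.mul_rpow_of_nonneg _ _ (by positivity), ← ENNReal.rpow_mul,
    mul_one_div_cancel hp.ne', ENNReal.rpow_one]

theorem HasNormD.aemeasurable {u : EuclideanSpace ℝ (Fin N) → ℝ} {a : ℝ≥0∞}
    (hu : HasNormD A p u a) : AEMeasurable u := by
  obtain ⟨φ, hφ, -, hlim, -⟩ := hu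
  exact aemeasurable_of_tendsto_metrizable_ae atTop
    (fun n => (hφ n).contDiff.continuous.measurable.aemeasurable) hlim

/-- A function in the unit ball of `D_A` coincides almost everywhere with a radial function whose
profile satisfies the estimates of `IsRadialLimit`. -/
theorem HasNormD.exists_isRadialLimit (hN : 0 < N) (hp : 1 < p) (hA : HypA N p a₀ aInf A)
    {u : EuclideanSpace ℝ (Fin N) → ℝ} {a : ℝ≥0∞} (hu : HasNormD A p u a) (ha : a ≤ 1) :
    ∃ h : ℝ → ℝ, IsRadialLimit (fun t => A t * t ^ (N - 1)) p
      ((sphereMass N)⁻¹ ^ (1 / p) * 2) h ∧ ∀ᵐ x, u x = h ‖x‖ := by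
  obtain ⟨φ, hφ, hC, hlim, hnorm⟩ := hu
  have hp0 : 0 < p := by linarith
  have hctop : (sphereMass N)⁻¹ ^ (1 / p) ≠ ⊤ :=
    ENNReal.rpow_ne_top_of_nonneg (by positivity) (ENNReal.inv_ne_top.2 (sphereMass_ne_zero hN))
  obtain ⟨e, he⟩ : ∃ e : EuclideanSpace ℝ (Fin N), ‖e‖ = 1 :=
    ⟨EuclideanSpace.single ⟨0, hN⟩ 1, by simp⟩
  have hdecay := hA.decay_weight_lt_top hN hp
  have hf : ∀ n, ContDiff ℝ 1 (profile e (φ n)) := fun n => contDiff_profile e (hφ n).contDiff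
  have hf0 : ∀ n, ∃ T, ∀ t, T ≤ t → profile e (φ n) t = 0 := fun n =>
    exists_profile_eq_zero he (hφ n).hasCompactSupport
  have hfC : Tendsto (fun k : ℕ × ℕ => energy (fun t => A t * t ^ (N - 1)) p
      (profile e (φ k.1) - profile e (φ k.2)) ^ (1 / p)) atTop (𝓝 0) := by
    have h1 := ENNReal.Tendsto.const_mul (a := (sphereMass N)⁻¹ ^ (1 / p)) hC (Or.inr hctop)
    rw [mul_zero] at h1
    refine tendsto_of_tendsto_of_tendsto_of_le_of_le tendsto_const_nhds h1
      (fun _ => zero_le) fun k => ?_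
    rw [← profile_sub]
    have hd : ContDiff ℝ ∞ (φ k.1 - φ k.2) := (hφ k.1).contDiff.sub (hφ k.2).contDiff
    refine energy_profile_rpow_le hN hp0 hA he hd fun x y hxy => ?_
    rw [Pi.sub_apply, Pi.sub_apply, (hφ k.1).radial x y hxy, (hφ k.2).radial x y hxy]
  have hB : ∀ᶠ n in atTop, energy (fun t => A t * t ^ (N - 1)) p (profile e (φ n)) ^ (1 / p) ≤
      (sphereMass N)⁻¹ ^ (1 / p) * 2 := by
    -- The norms converge to `a ≤ 1`, so they are eventually below `2`; any constant above `1` would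
    -- do.
    have h2 : a < 2 := ha.trans_lt (by norm_num)
    filter_upwards [(tendsto_order.1 hnorm).2 2 h2] with n hn
    refine (energy_profile_rpow_le hN hp0 hA he (hφ n).contDiff (hφ n).radial).trans ?_
    gcongr
  obtain ⟨h, hh⟩ := exists_tendsto_of_cauchy hp hA.continuousOn_weight hA.weight_pos hdecay hf hf0
    hfC
  refine ⟨h, isRadialLimit_of_tendsto hp hA.continuousOn_weight hA.weight_pos hdecay hf hf0
    (ENNReal.mul_lt_top hctop.lt_top (by simp)) hB hh, ?_⟩
  have : Nonempty (Fin N) := ⟨⟨0, hN⟩⟩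
  have h0 : ∀ᵐ x : EuclideanSpace ℝ (Fin N), x ≠ 0 := by simp [ae_iff]
  filter_upwards [hlim, h0] with x hx hx0
  refine tendsto_nhds_unique hx ?_
  refine (hh ‖x‖ (norm_pos_iff.2 hx0)).congr fun n => ?_
  exact (apply_eq_profile he (hφ n).radial x).symm

theorem HasNormX.exists_le_one (hp : 0 < p) {u : EuclideanSpace ℝ (Fin N) → ℝ}
    (hu : HasNormX A V p u 1) : ∃ a, HasNormD A p u a ∧ a ≤ 1 ∧
      ∫⁻ x, ENNReal.ofReal (V ‖x‖ * |u x| ^ p) ≤ 1 := by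
  obtain ⟨-, a, ha, h⟩ := hu
  have h1 : a ^ p + ∫⁻ x, ENNReal.ofReal (V ‖x‖ * |u x| ^ p) = 1 := by
    have h2 := congrArg (fun y : ℝ≥0∞ => y ^ p) h.symm
    simpa only [← ENNReal.rpow_mul, one_div_mul_cancel hp.ne', ENNReal.rpow_one,
      ENNReal.one_rpow] using h2
  refine ⟨a, ha, ?_, h1 ▸ le_add_self⟩
  exact (ENNReal.rpow_le_rpow_iff hp).1 (by rw [ENNReal.one_rpow]; exact h1 ▸ le_self_add)

/-- The pointwise radial estimate near the origin for the unit sphere of `X`. -/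
theorem exists_ae_rpow_le (hN : 0 < N) (hp : 1 < p) (hA : HypA N p a₀ aInf A)
    {γ R c : ℝ} (hR : 0 < R) (hc : 0 < c)
    (hV : ∀ᵐ r ∂(volume.restrict (Ioo 0 R)), c * r ^ (-γ) ≤ V r) {m : ℝ}
    (hm : m = (p * (N - 1) + a₀ - γ * (p - 1)) / p) (hmγ : 0 ≤ m ∨ m ≤ 0 ∧ (N : ℝ) ≤ γ) :
    ∃ C ρ : ℝ, 0 ≤ C ∧ 0 < ρ ∧ ∀ u : EuclideanSpace ℝ (Fin N) → ℝ, HasNormX A V p u 1 →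
      ∀ᵐ x, ‖x‖ ≤ ρ → |u x| ^ p ≤ C * ‖x‖ ^ (-m) := by
  have hp0 : 0 < p := by linarith
  have : Nonempty (Fin N) := ⟨⟨0, hN⟩⟩
  obtain ⟨cA, ρA, hcA, hρA, hAle⟩ := hA.exists_le_near_zero hN
  -- Half of `R` keeps the closed range `‖x‖ ≤ ρ` inside the open interval where `V` is bounded
  -- below.
  set ρ := min ρA (R / 2) with hρdef
  have hρ : 0 < ρ := lt_min hρA (half_pos hR)
  have hρR : ρ < R := (min_le_right _ _).trans_lt (half_lt_self hR)
  set B : ℝ≥0∞ := (sphereMass N)⁻¹ ^ (1 / p) * 2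
  set M : ℝ≥0∞ := (sphereMass N)⁻¹ * ENNReal.ofReal c⁻¹ with hM
  have hBtop : B < ⊤ := ENNReal.mul_lt_top (ENNReal.rpow_lt_top_of_nonneg (by positivity)
    (ENNReal.inv_ne_top.2 (sphereMass_ne_zero hN))) (by simp)
  have hMtop : M < ⊤ := ENNReal.mul_lt_top
    (ENNReal.inv_lt_top.2 (pos_iff_ne_zero.2 (sphereMass_ne_zero hN))) ENNReal.ofReal_lt_top
  set C : ℝ≥0∞ := (B * decay (fun t => A t * t ^ (N - 1)) p ρ) ^ p * ENNReal.ofReal (ρ ^ m) +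
    ENNReal.ofReal p * (B * (ENNReal.ofReal (cA ^ (-(1 / (p - 1)))) * M) ^ (1 - 1 / p)) with hC
  have h1p : 1 / p ≤ 1 := by rw [div_le_one hp0]; exact hp.le
  have hCtop : C < ⊤ := by
    refine ENNReal.add_lt_top.2 ⟨ENNReal.mul_lt_top (ENNReal.rpow_lt_top_of_nonneg hp0.le
      (ENNReal.mul_lt_top hBtop (hA.decay_weight_lt_top hN hp ρ hρ)).ne) ENNReal.ofReal_lt_top,
      ENNReal.mul_lt_top ENNReal.ofReal_lt_top (ENNReal.mul_lt_top hBtop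
        (ENNReal.rpow_lt_top_of_nonneg (by linarith)
          (ENNReal.mul_lt_top ENNReal.ofReal_lt_top hMtop).ne))⟩
  refine ⟨C.toReal, ρ, ENNReal.toReal_nonneg, hρ, fun u hu => ?_⟩
  obtain ⟨a, hD, ha, hint⟩ := hu.exists_le_one hp0
  obtain ⟨h, hh, huh⟩ := hD.exists_isRadialLimit hN hp hA ha
  have h0 : ∀ᵐ x : EuclideanSpace ℝ (Fin N), x ≠ 0 := by simp [ae_iff]
  -- The exponent `σ = N - 1 - γ` joins the polar density `t^(N-1)` to the lower bound of `V`.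
  have hbound : ∫⁻ t in Ioc 0 ρ, ENNReal.ofReal (t ^ ((N : ℝ) - 1 - γ) * |h t| ^ p) ≤ M := by
    have hpolar := lintegral_comp_norm_euclidean hN
      (f := (Ioc 0 ρ).indicator fun t => ENNReal.ofReal (t ^ (-γ) * |h t| ^ p))
      (AEMeasurable.indicator (by
        have := hh.aemeasurable
        exact ((measurable_id.pow_const _).aemeasurable.mul
          ((continuous_abs.measurable.comp_aemeasurable this).pow_const p)).ennreal_ofReal)
        measurableSet_Ioc)
    have hleft : ∫⁻ x : EuclideanSpace ℝ (Fin N),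
        (Ioc 0 ρ).indicator (fun t => ENNReal.ofReal (t ^ (-γ) * |h t| ^ p)) ‖x‖ ≤
          ENNReal.ofReal c⁻¹ := by
      calc _ ≤ ∫⁻ x : EuclideanSpace ℝ (Fin N),
            ENNReal.ofReal c⁻¹ * ENNReal.ofReal (V ‖x‖ * |u x| ^ p) := by
            refine lintegral_mono_ae ?_
            filter_upwards [huh, ae_ball_of_ae_Ioo volume hV] with x hx hVx
            by_cases hmem : ‖x‖ ∈ Ioc 0 ρ
            · rw [indicator_of_mem hmem, ← ENNReal.ofReal_mul (by positivity), hx]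
              refine ENNReal.ofReal_le_ofReal ?_
              rw [← mul_assoc]
              refine mul_le_mul_of_nonneg_right ?_ (by positivity)
              rw [← div_eq_inv_mul, le_div_iff₀ hc, mul_comm]
              exact hVx (hmem.2.trans_lt hρR)
            · rw [indicator_of_notMem hmem]
              exact zero_le
        _ ≤ ENNReal.ofReal c⁻¹ * 1 := by
            rw [lintegral_const_mul' _ _ ENNReal.ofReal_ne_top]
            gcongr
        _ = _ := mul_one _
    have hright : ∫⁻ t in Ioi (0 : ℝ), ENNReal.ofReal (t ^ (N - 1)) *
          (Ioc 0 ρ).indicator (fun t => ENNReal.ofReal (t ^ (-γ) * |h t| ^ p)) t =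
        ∫⁻ t in Ioc 0 ρ, ENNReal.ofReal (t ^ ((N : ℝ) - 1 - γ) * |h t| ^ p) := by
      rw [← lintegral_indicator measurableSet_Ioi, ← lintegral_indicator measurableSet_Ioc]
      refine lintegral_congr fun t => ?_
      by_cases ht : t ∈ Ioc 0 ρ
      · have ht0 : 0 < t := ht.1
        rw [indicator_of_mem ht, indicator_of_mem (show t ∈ Ioi (0 : ℝ) from ht.1),
          indicator_of_mem ht, ← ENNReal.ofReal_mul (by positivity), ← mul_assoc,
          mul_comm (t ^ (N - 1)), ← rpow_mul_pow_pred hN _ ht0]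
        congr 3
        ring
      · simp [ht]
    rw [hright] at hpolar
    rw [hpolar] at hleft
    rw [hM, mul_comm, ← div_eq_mul_inv, ENNReal.le_div_iff_mul_le
      (Or.inl (sphereMass_ne_zero hN)) (Or.inl sphereMass_ne_top), mul_comm]
    exact hleft
  filter_upwards [huh, h0] with x hx hx0 hxρ
  have hx' : 0 < ‖x‖ := norm_pos_iff.2 hx0
  have key := hh.ofReal_rpow_le hp (σ := (N : ℝ) - 1 - γ) (b := a₀ + N - 1) (m := m) hcA hρ
    (by rw [hm]; congr 1; ring)
    (hmγ.imp id fun hmg => ⟨hmg.1, by linarith [hmg.2]⟩)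
    (fun t ht htρ => hAle t ht (htρ.trans (min_le_left _ _))) hMtop hbound hx' hxρ
  rw [← hC, ← ENNReal.ofReal_toReal hCtop.ne, ← ENNReal.ofReal_mul ENNReal.toReal_nonneg,
    ENNReal.ofReal_le_ofReal_iff (by positivity)] at key
  rw [hx]
  exact key

end Space

end RadialQuasilinear

namespace RadialQuasilinear

/-! ### The region of exponents as two polynomial inequalities. -/

section Region

variable {N : ℕ} {p a β γ α q : ℝ}

theorem lt_critical_exponent (hp : 1 < p) (ha : p - N < a) :
    (N : ℝ) < (p * (N - 1) + a) / (p - 1) := by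
  rw [lt_div_iff₀ (by linarith)]
  linarith

theorem one_lt_and_of_mem_region (h : (α, q) ∈ region N p a β γ) : 1 < q ∧ p * β < q := by
  simp only [region, mem_ofPred_eq, max_lt_iff, lt_min_iff] at h
  rcases h with h | h | h | h | h
  · exact h.2.2.1
  · exact h.2.1
  · exact h.2.2.1.1
  · exact h.2.1.1
  · exact h.2.1

/-- Clearing the denominator `N - γ` reverses the inequality once `γ > N`, which is why `q_*` passes
from upper to lower bound. At `γ = N` only the condition on `α` survives. -/
theorem qStar_bound_of_mem_region (hp : 1 < p) (ha : p - N < a)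
    (h : (α, q) ∈ region N p a β γ) : q * (N - γ) < p * (α - γ * β + N) := by
  have hcrit := lt_critical_exponent hp ha
  simp only [region, mem_ofPred_eq, max_lt_iff, lt_min_iff, qStar, ← mul_div_assoc] at h
  rcases h with ⟨-, h1, -, h2, -⟩ | ⟨h1, -, -, h2⟩ | ⟨h1, -, ⟨-, h2⟩, -⟩ | ⟨h1, ⟨-, h2⟩, -⟩ |
    ⟨h1, -, h2, -⟩
  · exact (lt_div_iff₀ (by linarith)).1 h2
  · subst h1
    rw [sub_self, mul_zero]
    exact mul_pos (by linarith) (by linarith)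
  · exact (div_lt_iff_of_neg (by linarith)).1 h2
  · exact (div_lt_iff_of_neg (by linarith)).1 h2
  · exact (div_lt_iff_of_neg (by linarith)).1 h2

/-- With `D` the denominator of `q_**`, one has `q_** - p = p²(α + γ(1-β))/D`. The sign of `D`
changes at `γ*`, where the inequality reduces to the condition on `α`. -/
theorem qStarStar_bound_of_mem_region (hp : 1 < p) (ha : p - N < a)
    (h : (α, q) ∈ region N p a β γ) :
    (p * (N - 1) - γ * (p - 1) + a) * (q - p) < p ^ 2 * (α + γ * (1 - β)) := by
  have hcrit := lt_critical_exponent hp ha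
  have hp1 : 0 < p - 1 := by linarith
  have hlt : γ < (p * (N - 1) + a) / (p - 1) → 0 < p * (N - 1) - γ * (p - 1) + a := fun h => by
    rw [lt_div_iff₀ hp1] at h
    linarith
  have hgt : (p * (N - 1) + a) / (p - 1) < γ → p * (N - 1) - γ * (p - 1) + a < 0 := fun h => by
    rw [div_lt_iff₀ hp1] at h
    linarith
  simp only [region, mem_ofPred_eq, max_lt_iff, lt_min_iff, qStarStar, ← mul_div_assoc] at h
  rcases h with ⟨-, h1, -, -, h2⟩ | ⟨h1, -, h2, -⟩ | ⟨-, h1, -, h2⟩ | ⟨h1, -, h2⟩ |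
    ⟨h1, -, -, h2⟩
  · rw [lt_div_iff₀ (hlt (by linarith))] at h2
    linarith
  · rw [lt_div_iff₀ (hlt (by linarith))] at h2
    linarith
  · rw [lt_div_iff₀ (hlt h1)] at h2
    linarith
  · have h3 : p * (N - 1) - γ * (p - 1) + a = 0 := by
      rw [eq_div_iff hp1.ne'] at h1
      linarith
    rw [h3, zero_mul]
    exact mul_pos (by positivity) (by linarith)
  · rw [div_lt_iff_of_neg (hgt h1)] at h2
    linarith

end Region

/-! ### Pointwise bounds of the integrand and integrals of powers over balls. -/

section Integrands

variable {p q α β γ : ℝ}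

/-- Bound of the integrand above the exponent `p`, by means of a pointwise estimate. -/
theorem mul_rpow_le_of_le {k v y r c C D m : ℝ} (hp : 0 < p) (hpq : p ≤ q) (hβ : β ≤ 1)
    (hr : 0 < r) (hc : 0 < c) (hC : 0 ≤ C) (hD : 0 ≤ D) (hy : 0 ≤ y) (hv : c * r ^ (-γ) ≤ v)
    (hk : k ≤ C * (r ^ α * v ^ β)) (hyD : y ^ p ≤ D * r ^ (-m)) :
    k * y ^ q ≤ C * c ^ (β - 1) * D ^ ((q - p) / p) *
      r ^ (α + γ * (1 - β) - m * ((q - p) / p)) * (v * y ^ p) := by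
  have hv0 : 0 < v := lt_of_lt_of_le (by positivity) hv
  have h1 : v ^ β ≤ v * (c ^ (β - 1) * r ^ (γ * (1 - β))) := by
    have h2 : v ^ (β - 1) ≤ (c * r ^ (-γ)) ^ (β - 1) :=
      Real.rpow_le_rpow_of_nonpos (by positivity) hv (by linarith)
    rw [Real.mul_rpow hc.le (by positivity), ← Real.rpow_mul hr.le,
      show -γ * (β - 1) = γ * (1 - β) by ring] at h2
    calc v ^ β = v * v ^ (β - 1) := by
          nth_rewrite 2 [← Real.rpow_one v]
          rw [← Real.rpow_add hv0]
          congr 1; ring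
      _ ≤ _ := by gcongr
  have h3 : y ^ q ≤ y ^ p * (D ^ ((q - p) / p) * r ^ (-m * ((q - p) / p))) := by
    have h4 : (y ^ p) ^ ((q - p) / p) ≤ (D * r ^ (-m)) ^ ((q - p) / p) :=
      Real.rpow_le_rpow (by positivity) hyD (div_nonneg (by linarith) hp.le)
    rw [Real.mul_rpow hD (by positivity), ← Real.rpow_mul hr.le, ← Real.rpow_mul hy,
      mul_div_cancel₀ _ hp.ne'] at h4
    calc y ^ q = y ^ p * y ^ (q - p) := by
          rw [← Real.rpow_add_of_nonneg hy hp.le (by linarith)]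
          congr 1; ring
      _ ≤ _ := by gcongr
  calc k * y ^ q ≤ (C * (r ^ α * (v * (c ^ (β - 1) * r ^ (γ * (1 - β)))))) *
        (y ^ p * (D ^ ((q - p) / p) * r ^ (-m * ((q - p) / p)))) := by
        refine mul_le_mul (hk.trans ?_) h3 (by positivity) (by positivity)
        gcongr
    _ = _ := by
        rw [show α + γ * (1 - β) - m * ((q - p) / p) =
          α + γ * (1 - β) + -m * ((q - p) / p) by ring, Real.rpow_add hr, Real.rpow_add hr]
        ring

/-- Bound of the integrand below the exponent `p`, in the form suited to Hölder's inequality. -/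
theorem mul_rpow_le_of_lt {k v y r c C : ℝ} (hp : 0 < p) (hβq : p * β ≤ q) (hqp : q < p)
    (hr : 0 < r) (hc : 0 < c) (hC : 0 ≤ C) (hy : 0 ≤ y) (hv : c * r ^ (-γ) ≤ v)
    (hk : k ≤ C * (r ^ α * v ^ β)) :
    k * y ^ q ≤ C * c ^ (β - q / p) * ((v * y ^ p) ^ (q / p) *
      (r ^ ((α - γ * (β - q / p)) * (p / (p - q)))) ^ (1 - q / p)) := by
  have hv0 : 0 < v := lt_of_lt_of_le (by positivity) hv
  have hpq : p - q ≠ 0 := by linarith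
  -- The exponent is nonpositive because `q ≥ pβ`, so the lower bound on `v` becomes an upper bound
  -- on `v^(β - q/p)`.
  have hβ : β - q / p ≤ 0 := by
    rw [sub_nonpos, le_div_iff₀ hp]
    linarith
  have h1 : v ^ β ≤ v ^ (q / p) * (c ^ (β - q / p) * r ^ (-γ * (β - q / p))) := by
    have h2 : v ^ (β - q / p) ≤ (c * r ^ (-γ)) ^ (β - q / p) :=
      Real.rpow_le_rpow_of_nonpos (by positivity) hv hβ
    rw [Real.mul_rpow hc.le (by positivity), ← Real.rpow_mul hr.le] at h2
    calc v ^ β = v ^ (q / p) * v ^ (β - q / p) := by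
          rw [← Real.rpow_add hv0]
          congr 1; ring
      _ ≤ _ := by gcongr
  calc k * y ^ q ≤ (C * (r ^ α * (v ^ (q / p) * (c ^ (β - q / p) *
        r ^ (-γ * (β - q / p)))))) * y ^ q := by
        refine mul_le_mul_of_nonneg_right (hk.trans ?_) (by positivity)
        gcongr
    _ = _ := by
        rw [Real.mul_rpow hv0.le (by positivity), ← Real.rpow_mul hy, mul_div_cancel₀ _ hp.ne',
          ← Real.rpow_mul hr.le,
          show (α - γ * (β - q / p)) * (p / (p - q)) * (1 - q / p) =
            α + -γ * (β - q / p) by field_simp; ring, Real.rpow_add hr]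
        ring

theorem lintegral_ball_norm_rpow {N : ℕ} (hN : 0 < N) {η R : ℝ} (hη : 0 < η + N) (hR : 0 < R) :
    ∫⁻ x in Metric.ball (0 : EuclideanSpace ℝ (Fin N)) R, ENNReal.ofReal (‖x‖ ^ η) =
      sphereMass N * ENNReal.ofReal (R ^ (η + N) / (η + N)) := by
  have hpolar := lintegral_comp_norm_euclidean hN
    (f := (Iio R).indicator fun t => ENNReal.ofReal (t ^ η))
    (Measurable.indicator (by fun_prop) measurableSet_Iio).aemeasurable
  rw [← lintegral_indicator measurableSet_ball]
  calc _ = ∫⁻ x : EuclideanSpace ℝ (Fin N),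
        (Iio R).indicator (fun t => ENNReal.ofReal (t ^ η)) ‖x‖ := by
        refine lintegral_congr fun x => ?_
        simp [indicator]
    _ = _ := by
        rw [hpolar]
        congr 1
        have h1 : ∫⁻ t in Ioi (0 : ℝ), ENNReal.ofReal (t ^ (N - 1)) *
            (Iio R).indicator (fun t => ENNReal.ofReal (t ^ η)) t =
            ∫⁻ t in Ioo 0 R, ENNReal.ofReal (t ^ (η + N - 1)) := by
          rw [← lintegral_indicator measurableSet_Ioi, ← lintegral_indicator measurableSet_Ioo]
          refine lintegral_congr fun t => ?_
          by_cases ht : 0 < t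
          · by_cases htR : t < R
            · rw [indicator_of_mem (show t ∈ Ioi (0 : ℝ) from ht),
                indicator_of_mem (show t ∈ Iio R from htR),
                indicator_of_mem (show t ∈ Ioo 0 R from ⟨ht, htR⟩),
                ← ENNReal.ofReal_mul (by positivity), rpow_mul_pow_pred hN _ ht, mul_comm]
            · simp [htR]
          · simp [ht]
        have hint : IntervalIntegrable (fun t : ℝ => t ^ (η + N - 1)) volume 0 R :=
          intervalIntegral.intervalIntegrable_rpow' (by linarith)
        rw [h1, setLIntegral_congr Ioo_ae_eq_Ioc, ← ofReal_integral_eq_lintegral_ofReal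
          ((intervalIntegrable_iff_integrableOn_Ioc_of_le hR.le).1 hint)
          ((ae_restrict_iff' measurableSet_Ioc).2 (ae_of_all _ fun t ht =>
            Real.rpow_nonneg (le_of_lt ht.1) _)),
          ← intervalIntegral.integral_of_le hR.le, integral_rpow (Or.inl (by linarith)),
          sub_add_cancel, Real.zero_rpow hη.ne', sub_zero]

end Integrands

/-! ### Vanishing of the supremum on the two sides of `p`. -/

section Vanishing

variable {N : ℕ} {p q R₁ α β γ a₀ aInf c C : ℝ} {A V K : ℝ → ℝ}

theorem tendsto_ofReal_rpow_zero {ε : ℝ} (hε : 0 < ε) :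
    Tendsto (fun R : ℝ => ENNReal.ofReal (R ^ ε)) (𝓝[>] 0) (𝓝 0) := by
  have h : Tendsto (fun R : ℝ => R ^ ε) (𝓝[>] 0) (𝓝 0) := by
    have h1 := (Real.continuousAt_rpow_const 0 ε (Or.inr hε.le)).tendsto
    rw [Real.zero_rpow hε.ne'] at h1
    exact h1.mono_left nhdsWithin_le_nhds
  simpa using ENNReal.tendsto_ofReal h

theorem aemeasurable_comp_norm (hN : 0 < N) (hV : AEMeasurable V (volume.restrict (Ioi 0))) :
    AEMeasurable fun x : EuclideanSpace ℝ (Fin N) => V ‖x‖ := by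
  have : Nonempty (Fin N) := ⟨⟨0, hN⟩⟩
  exact hV.comp_quasiMeasurePreserving (quasiMeasurePreserving_norm volume)

theorem tendsto_S₀_of_lt (hN : 0 < N) (hp : 1 < p) (hV : AEMeasurable V (volume.restrict (Ioi 0)))
    (hR₁ : 0 < R₁) (hc : 0 < c) (hC : 0 ≤ C)
    (hVc : ∀ᵐ r ∂(volume.restrict (Ioo 0 R₁)), c * r ^ (-γ) ≤ V r)
    (hK : ∀ᵐ r ∂(volume.restrict (Ioo 0 R₁)), K r ≤ C * (r ^ α * V r ^ β))
    (hq : 0 < q) (hβq : p * β ≤ q) (hqp : q < p) (hα : q * (N - γ) < p * (α - γ * β + N)) :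
    Tendsto (fun R : ℝ => S₀ N A V K p q R) (𝓝[>] 0) (𝓝 0) := by
  have hp0 : 0 < p := by linarith
  have hpq : 0 < p - q := by linarith
  have hqp1 : q / p < 1 := (div_lt_one hp0).2 hqp
  have : Nonempty (Fin N) := ⟨⟨0, hN⟩⟩
  set η := (α - γ * (β - q / p)) * (p / (p - q)) with hηdef
  have hη : 0 < η + N := by
    have : η + N = (p * (α - γ * β + N) - q * (N - γ)) / (p - q) := by
      rw [hηdef]
      field_simp
      ring
    rw [this]
    exact div_pos (by linarith) hpq
  have hle : ∀ R, 0 < R → R ≤ R₁ → S₀ N A V K p q R ≤ ENNReal.ofReal (C * c ^ (β - q / p)) *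
      (sphereMass N * (ENNReal.ofReal (R ^ (η + N)) * ENNReal.ofReal (η + N)⁻¹)) ^
        (1 - q / p) := by
    intro R hR hRR
    refine iSup₂_le fun u hu => ?_
    obtain ⟨a, hD, -, hint⟩ := hu.exists_le_one hp0
    have h0 : ∀ᵐ x : EuclideanSpace ℝ (Fin N), x ≠ 0 := by simp [ae_iff]
    have hm : AEMeasurable fun x => ENNReal.ofReal (V ‖x‖ * |u x| ^ p) :=
      ((aemeasurable_comp_norm hN hV).mul
        ((continuous_abs.measurable.comp_aemeasurable hD.aemeasurable).pow_const p)).ennreal_ofReal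
    have hball := lintegral_ball_norm_rpow hN hη hR
    rw [div_eq_mul_inv, ENNReal.ofReal_mul (by positivity)] at hball
    calc ∫⁻ x in Metric.ball 0 R, ENNReal.ofReal (K ‖x‖ * |u x| ^ q)
        ≤ ∫⁻ x in Metric.ball 0 R, ENNReal.ofReal (C * c ^ (β - q / p)) *
            (ENNReal.ofReal (V ‖x‖ * |u x| ^ p) ^ (q / p) *
              ENNReal.ofReal (‖x‖ ^ η) ^ (1 - q / p)) := by
          refine lintegral_mono_ae ((ae_restrict_iff' measurableSet_ball).2 ?_)
          filter_upwards [h0, ae_ball_of_ae_Ioo volume hVc, ae_ball_of_ae_Ioo volume hK]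
            with x hx hVx hKx hxR
          have hxR₁ : ‖x‖ < R₁ := (mem_ball_zero_iff.1 hxR).trans_le hRR
          have hx0 : 0 < ‖x‖ := norm_pos_iff.2 hx
          have hV0 : 0 ≤ V ‖x‖ := le_trans (by positivity) (hVx hxR₁)
          rw [ENNReal.ofReal_rpow_of_nonneg (by positivity) (by positivity),
            ENNReal.ofReal_rpow_of_nonneg (by positivity) (by linarith),
            ← ENNReal.ofReal_mul (by positivity), ← ENNReal.ofReal_mul (by positivity)]
          exact ENNReal.ofReal_le_ofReal (mul_rpow_le_of_lt hp0 hβq hqp hx0 hc hC (abs_nonneg _)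
            (hVx hxR₁) (hKx hxR₁))
      _ = ENNReal.ofReal (C * c ^ (β - q / p)) *
          ∫⁻ x in Metric.ball 0 R, ENNReal.ofReal (V ‖x‖ * |u x| ^ p) ^ (q / p) *
              ENNReal.ofReal (‖x‖ ^ η) ^ (1 - q / p) :=
          lintegral_const_mul' _ _ ENNReal.ofReal_ne_top
      _ ≤ ENNReal.ofReal (C * c ^ (β - q / p)) *
          ((∫⁻ x in Metric.ball 0 R, ENNReal.ofReal (V ‖x‖ * |u x| ^ p)) ^ (q / p) *
            (∫⁻ x in Metric.ball (0 : EuclideanSpace ℝ (Fin N)) R,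
              ENNReal.ofReal (‖x‖ ^ η)) ^ (1 - q / p)) := by
          gcongr
          exact ENNReal.lintegral_mul_norm_pow_le hm.restrict
            (measurable_norm.pow_const η).ennreal_ofReal.aemeasurable (by positivity)
            (by linarith) (by ring)
      _ ≤ ENNReal.ofReal (C * c ^ (β - q / p)) * (1 ^ (q / p) *
            (∫⁻ x in Metric.ball (0 : EuclideanSpace ℝ (Fin N)) R,
              ENNReal.ofReal (‖x‖ ^ η)) ^ (1 - q / p)) := by
          gcongr
          exact (setLIntegral_le_lintegral _ _).trans hint
      _ = _ := by rw [ENNReal.one_rpow, one_mul, hball]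
  have hlim : Tendsto (fun R : ℝ => ENNReal.ofReal (C * c ^ (β - q / p)) *
      (sphereMass N * (ENNReal.ofReal (R ^ (η + N)) * ENNReal.ofReal (η + N)⁻¹)) ^
        (1 - q / p)) (𝓝[>] 0) (𝓝 0) := by
    have h1 := ENNReal.Tendsto.mul_const (b := ENNReal.ofReal (η + N)⁻¹)
      (tendsto_ofReal_rpow_zero hη) (Or.inr ENNReal.ofReal_ne_top)
    have h2 := ENNReal.Tendsto.const_mul (a := sphereMass N) h1 (Or.inr sphereMass_ne_top)
    have h3 := ENNReal.Tendsto.const_mul (a := ENNReal.ofReal (C * c ^ (β - q / p)))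
      (h2.ennrpow_const (1 - q / p)) (Or.inr ENNReal.ofReal_ne_top)
    simpa [ENNReal.zero_rpow_of_pos (show 0 < 1 - q / p by linarith)] using h3
  refine tendsto_of_tendsto_of_tendsto_of_le_of_le' tendsto_const_nhds hlim
    (Eventually.of_forall fun _ => zero_le) ?_
  filter_upwards [Ioo_mem_nhdsGT hR₁] with R hR using hle R hR.1 hR.2.le

theorem tendsto_S₀_of_le (hN : 0 < N) (hp : 1 < p) (hA : HypA N p a₀ aInf A) (hR₁ : 0 < R₁)
    (hc : 0 < c) (hC : 0 ≤ C)
    (hVc : ∀ᵐ r ∂(volume.restrict (Ioo 0 R₁)), c * r ^ (-γ) ≤ V r)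
    (hK : ∀ᵐ r ∂(volume.restrict (Ioo 0 R₁)), K r ≤ C * (r ^ α * V r ^ β))
    (hβ : β ≤ 1) (hpq : p ≤ q)
    (hα : (p * (N - 1) - γ * (p - 1) + a₀) * (q - p) < p ^ 2 * (α + γ * (1 - β))) :
    Tendsto (fun R : ℝ => S₀ N A V K p q R) (𝓝[>] 0) (𝓝 0) := by
  have hp0 : 0 < p := by linarith
  have : Nonempty (Fin N) := ⟨⟨0, hN⟩⟩
  set m := (p * (N - 1) + a₀ - γ * (p - 1)) / p with hm
  -- A negative `m` means that `γ` exceeds `γ*`, and `γ* > N` because `a₀ > p - N`.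
  have hmγ : 0 ≤ m ∨ m ≤ 0 ∧ (N : ℝ) ≤ γ := by
    rcases le_or_gt 0 m with h | h
    · exact Or.inl h
    · refine Or.inr ⟨h.le, ?_⟩
      rw [hm, div_neg_iff] at h
      have h1 : p * (N - 1) + a₀ < γ * (p - 1) := by
        rcases h with h | h <;> linarith [h.1, h.2]
      have h2 := lt_critical_exponent hp hA.mem_zero.1
      rw [← div_lt_iff₀ (by linarith)] at h1
      linarith
  obtain ⟨D, ρ, hD, hρ, hpt⟩ := exists_ae_rpow_le hN hp hA hR₁ hc hVc hm hmγ
  set ε := α + γ * (1 - β) - m * ((q - p) / p) with hεdef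
  have hε : 0 < ε := by
    have : ε = (p ^ 2 * (α + γ * (1 - β)) -
        (p * (N - 1) - γ * (p - 1) + a₀) * (q - p)) / p ^ 2 := by
      rw [hεdef, hm]
      field_simp
      ring
    rw [this]
    exact div_pos (by linarith) (by positivity)
  set L := C * c ^ (β - 1) * D ^ ((q - p) / p)
  have hL : 0 ≤ L := by positivity
  have hle : ∀ R, 0 < R → R < min ρ R₁ →
      S₀ N A V K p q R ≤ ENNReal.ofReal L * ENNReal.ofReal (R ^ ε) := by
    intro R hR hRlt
    refine iSup₂_le fun u hu => ?_
    obtain ⟨a, -, -, hint⟩ := hu.exists_le_one hp0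
    have h0 : ∀ᵐ x : EuclideanSpace ℝ (Fin N), x ≠ 0 := by simp [ae_iff]
    calc ∫⁻ x in Metric.ball 0 R, ENNReal.ofReal (K ‖x‖ * |u x| ^ q)
        ≤ ∫⁻ x in Metric.ball 0 R, ENNReal.ofReal L * ENNReal.ofReal (R ^ ε) *
            ENNReal.ofReal (V ‖x‖ * |u x| ^ p) := by
          refine lintegral_mono_ae ((ae_restrict_iff' measurableSet_ball).2 ?_)
          filter_upwards [h0, ae_ball_of_ae_Ioo volume hVc, ae_ball_of_ae_Ioo volume hK, hpt u hu]
            with x hx hVx hKx hux hxR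
          rw [mem_ball_zero_iff] at hxR
          have hxR₁ : ‖x‖ < R₁ := hxR.trans (hRlt.trans_le (min_le_right _ _))
          have hxρ : ‖x‖ ≤ ρ := (hxR.trans (hRlt.trans_le (min_le_left _ _))).le
          have hx0 : 0 < ‖x‖ := norm_pos_iff.2 hx
          have hV0 : 0 ≤ V ‖x‖ := le_trans (by positivity) (hVx hxR₁)
          rw [← ENNReal.ofReal_mul hL, ← ENNReal.ofReal_mul (by positivity)]
          refine ENNReal.ofReal_le_ofReal ((mul_rpow_le_of_le hp0 hpq hβ hx0 hc hC hD
            (abs_nonneg _) (hVx hxR₁) (hKx hxR₁) (hux hxρ)).trans ?_)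
          gcongr
      _ = ENNReal.ofReal L * ENNReal.ofReal (R ^ ε) *
            ∫⁻ x in Metric.ball 0 R, ENNReal.ofReal (V ‖x‖ * |u x| ^ p) :=
          lintegral_const_mul' _ _ (ENNReal.mul_ne_top ENNReal.ofReal_ne_top
            ENNReal.ofReal_ne_top)
      _ ≤ ENNReal.ofReal L * ENNReal.ofReal (R ^ ε) * 1 := by
          gcongr
          exact (setLIntegral_le_lintegral _ _).trans hint
      _ = _ := mul_one _
  have hlim : Tendsto (fun R : ℝ => ENNReal.ofReal L * ENNReal.ofReal (R ^ ε)) (𝓝[>] 0)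
      (𝓝 0) := by
    simpa using ENNReal.Tendsto.const_mul (a := ENNReal.ofReal L) (tendsto_ofReal_rpow_zero hε)
      (Or.inr ENNReal.ofReal_ne_top)
  refine tendsto_of_tendsto_of_tendsto_of_le_of_le' tendsto_const_nhds hlim
    (Eventually.of_forall fun _ => zero_le) ?_
  filter_upwards [Ioo_mem_nhdsGT (lt_min hρ hR₁)] with R hR using hle R hR.1 hR.2

end Vanishing

end RadialQuasilinear

/-! ### Conclusion. -/

theorem theorem3p3 (N : ℕ) (hN : 3 ≤ N) (p : ℝ) (hp1 : 1 < p) (hpN : p < N)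
    (A V K : ℝ → ℝ) (a₀ aInf : ℝ)
    (hA : RadialQuasilinear.HypA N p a₀ aInf A)
    (hV : RadialQuasilinear.HypV V)
    (hK : RadialQuasilinear.HypK K)
    (R₁ : ℝ) (hR₁ : 0 < R₁)
    (α₀ β₀ γ₀ : ℝ) (hβ₀ : 0 ≤ β₀) (hβ₁ : β₀ ≤ 1) (hγ₀ : p - a₀ ≤ γ₀)
    (hKV : essSup (fun r : ℝ => ENNReal.ofReal (K r) / ENNReal.ofReal (r ^ α₀ * V r ^ β₀))
      (volume.restrict (Ioo 0 R₁)) < ⊤)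
    (hVlow : 0 < essInf (fun r : ℝ => ENNReal.ofReal (r ^ γ₀ * V r))
      (volume.restrict (Ioo 0 R₁)))
    (q₁ : ℝ) (hq₁ : (α₀, q₁) ∈ RadialQuasilinear.region N p a₀ β₀ γ₀) :
    Tendsto (fun R : ℝ => RadialQuasilinear.S₀ N A V K p q₁ R) (𝓝[>] 0) (𝓝 0) := by
  have hN0 : 0 < N := by omega
  obtain ⟨c, hc, hVc⟩ := RadialQuasilinear.exists_rpow_neg_le_of_essInf_pos hVlow
  -- The lower bound makes `V` positive almost everywhere near the origin, so the quotient in `hKV`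
  -- can be cleared.
  have hW : ∀ᵐ r ∂(volume.restrict (Ioo 0 R₁)), 0 < r ^ α₀ * V r ^ β₀ := by
    filter_upwards [hVc, ae_restrict_mem measurableSet_Ioo] with r hr hmem
    have hr0 : 0 < r := hmem.1
    have hV0 : 0 < V r := lt_of_lt_of_le (by positivity) hr
    positivity
  obtain ⟨C, hC, hKC⟩ := RadialQuasilinear.exists_le_mul_of_essSup_lt_top hW hKV
  obtain ⟨hq1, hqβ⟩ := RadialQuasilinear.one_lt_and_of_mem_region hq₁
  rcases lt_or_ge q₁ p with hqp | hpq
  · exact RadialQuasilinear.tendsto_S₀_of_lt hN0 hp1 hV.measurable hR₁ hc hC hVc hKC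
      (by linarith) hqβ.le hqp
      (RadialQuasilinear.qStar_bound_of_mem_region hp1 hA.mem_zero.1 hq₁)
  · exact RadialQuasilinear.tendsto_S₀_of_le hN0 hp1 hA hR₁ hc hC hVc hKC hβ₁ hpq
      (RadialQuasilinear.qStarStar_bound_of_mem_region hp1 hA.mem_zero.1 hq₁)
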